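/- Let $\mathfrak{sl}(3,\mathbb{C})$ be the Lie algebra of traceless complex $3\times 3$ matrices, with Chevalley basis $x_i,y_i$ ($1\le i\le 3$), $h_1,h_2$ determined by $$ah_1+bh_2+cx_1+dx_2+ex_3+c'y_1+d'y_2+e'y_3=\begin{pmatrix} a & c & -e\\ c' & b-a & d\\ -e' & d' & -b\end{pmatrix},$$ and let $\langle W_1,\dots,W_m\rangle$ denote the Lie subalgebra generated by $W_1,\dots,W_m$. Two subalgebras are called equivalent if some inner automorphism of $\mathfrak{sl}(3,\mathbb{C})$ maps one onto the other, where the inner automorphisms are the elements of the group generated by all $\exp(\operatorname{ad} x)$ with $\operatorname{ad} x$ nilpotent. Let $L_2$, $L_{3,a}$ ($a\in\mathbb{C}$), $L_4$, $L_5$ be the complex Lie algebras with basis $z_1,z_2,z_3$ and the following brackets (all brackets of basis elements not determined by these are zero): - $L_2$: $[z_3,z_1]=z_1$, $[z_3,z_2]=z_2$; - $L_{3,a}$: $[z_3,z_1]=z_2$, $[z_3,z_2]=az_1+z_2$; - $L_4$: $[z_3,z_1]=z_2$, $[z_3,z_2]=z_1$; - $L_5$: $[z_3,z_1]=z_2$.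 **Theorem.** The following is a classification of the $3$-dimensional solvable subalgebras of $\mathfrak{sl}(3,\mathbb{C})$ up to inner automorphism, where $\alpha\in\mathbb{C}$, $\alpha\neq\pm1$, and $a(\alpha)=-\frac{(2\alpha-1)(\alpha-2)}{9(\alpha-1)^2}$: $$\begin{aligned} L_2^1&=\langle x_1,x_3,2h_1+h_2\rangle, & L_2^2&=\langle x_1,y_2,h_1-h_2\rangle,\\ L_{3,-1/4}^1&=\langle x_1,x_3,2h_1+h_2+x_2\rangle, & L_{3,-1/4}^2&=\langle y_1,y_3,2h_1+h_2+x_2\rangle,\\ L_{3,-2/9}^1&=\langle x_1+x_2,x_3,h_1+h_2\rangle, & L_{3,0}^1&=\langle x_1,h_1,h_2\rangle,\\ L_{3,a(\alpha)}^{1,\alpha}&=\langle x_1,x_3,(\alpha-1)h_1+\alpha h_2\rangle, & L_{3,a(\alpha)}^{2,\alpha}&=\langle x_1,y_2,h_1+\alpha h_2\rangle,\\ L_4^1&=\langle x_1,x_3,h_2\rangle, & L_4^2&=\langle x_1,y_2,h_1+h_2\rangle,\\ L_5^1&=\langle x_1,x_2,x_3\rangle. \end{aligned}$$ That is: each of these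 is a $3$-dimensional solvable subalgebra, isomorphic to the Lie algebra named by its subscript; every $3$-dimensional solvable subalgebra of $\mathfrak{sl}(3,\mathbb{C})$ is equivalent to one of them; and two differently labelled members of the list are inequivalent, except as follows. For $\alpha,\beta\in\mathbb{C}\setminus\{1,-1\}$ and each $i\in\{1,2\}$, $L_{3,a(\alpha)}^{i,\alpha}$ is equivalent to $L_{3,a(\beta)}^{i,\beta}$ if and only if $\alpha=\beta$ or $\alpha\beta=1$. -/

import Mathlib

/-- The inner automorphisms of a complex Lie algebra `L`: the subgroup of the automorphism group of
`L` generated by the automorphisms `exp (ad x)`, where `x` runs over the ad-nilpotent elements.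
If `(ad x) ^ n = 0`, then `exp (ad x)` is the finite sum of `(ad x) ^ i / i!` over `i < n`. -/
inductive IsInnerAut {L : Type*} [LieRing L] [LieAlgebra ℂ L] : (L ≃ₗ⁅ℂ⁆ L) → Prop
  | exp_ad (x : L) (n : ℕ) (hx : (LieAlgebra.ad ℂ L x) ^ n = 0) (φ : L ≃ₗ⁅ℂ⁆ L)
      (hφ : ∀ y : L, φ y =
        ∑ i ∈ Finset.range n, ((i.factorial : ℂ)⁻¹) • ((LieAlgebra.ad ℂ L x) ^ i) y) : IsInnerAut φ
  | refl : IsInnerAut LieEquiv.refl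
  | symm (φ : L ≃ₗ⁅ℂ⁆ L) (hφ : IsInnerAut φ) : IsInnerAut φ.symm
  | trans (φ ψ : L ≃ₗ⁅ℂ⁆ L) (hφ : IsInnerAut φ) (hψ : IsInnerAut ψ) : IsInnerAut (φ.trans ψ)

/-- Two subalgebras are equivalent up to inner automorphism if some inner automorphism of the
ambient Lie algebra maps the first one onto the second one. -/
def InnerEquivalent {L : Type*} [LieRing L] [LieAlgebra ℂ L] (K K' : LieSubalgebra ℂ L) : Prop :=
  ∃ φ : L ≃ₗ⁅ℂ⁆ L, IsInnerAut φ ∧ K.map (φ : L →ₗ⁅ℂ⁆ L) = K'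

/-! ### Isomorphism types of three-dimensional solvable Lie algebras

`T` has the given type if it has a basis `z₁, z₂, z₃` (indexed here by `0, 1, 2`) satisfying the
listed commutation relations. -/

/-- `T` is isomorphic to `L₂`: `[z₃, z₁] = z₁`, `[z₃, z₂] = z₂`, `[z₁, z₂] = 0`. -/
def IsTypeL2 (T : Type*) [LieRing T] [LieAlgebra ℂ T] : Prop :=
  ∃ z : Module.Basis (Fin 3) ℂ T, ⁅z 2, z 0⁆ = z 0 ∧ ⁅z 2, z 1⁆ = z 1 ∧ ⁅z 0, z 1⁆ = 0

/-- `T` is isomorphic to `L_{3,a}`: `[z₃, z₁] = z₂`, `[z₃, z₂] = a z₁ + z₂`, `[z₁, z₂] = 0`. -/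
def IsTypeL3 (a : ℂ) (T : Type*) [LieRing T] [LieAlgebra ℂ T] : Prop :=
  ∃ z : Module.Basis (Fin 3) ℂ T,
    ⁅z 2, z 0⁆ = z 1 ∧ ⁅z 2, z 1⁆ = a • z 0 + z 1 ∧ ⁅z 0, z 1⁆ = 0

/-- `T` is isomorphic to `L₄`: `[z₃, z₁] = z₂`, `[z₃, z₂] = z₁`, `[z₁, z₂] = 0`. -/
def IsTypeL4 (T : Type*) [LieRing T] [LieAlgebra ℂ T] : Prop :=
  ∃ z : Module.Basis (Fin 3) ℂ T, ⁅z 2, z 0⁆ = z 1 ∧ ⁅z 2, z 1⁆ = z 0 ∧ ⁅z 0, z 1⁆ = 0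

/-- `T` is isomorphic to `L₅`: `[z₃, z₁] = z₂`, `[z₃, z₂] = 0`, `[z₁, z₂] = 0`. -/
def IsTypeL5 (T : Type*) [LieRing T] [LieAlgebra ℂ T] : Prop :=
  ∃ z : Module.Basis (Fin 3) ℂ T, ⁅z 2, z 0⁆ = z 1 ∧ ⁅z 2, z 1⁆ = 0 ∧ ⁅z 0, z 1⁆ = 0

namespace A2

/-- The simple Lie algebra `A₂ = sl(3, ℂ)` of traceless complex `3 × 3` matrices. -/
abbrev Alg : Type := LieAlgebra.SpecialLinear.sl (Fin 3) ℂ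

/-- The general element `a h₁ + b h₂ + c x₁ + d x₂ + e x₃ + c' y₁ + d' y₂ + e' y₃` of `sl(3, ℂ)`. -/
def elt (a b c d e c' d' e' : ℂ) : Alg :=
  ⟨!![a, c, -e; c', b - a, d; -e', d', -b], by
    change Matrix.trace (n := Fin 3) (R := ℂ) _ = 0
    rw [Matrix.trace_fin_three]
    simp⟩

/-! The Chevalley basis. -/

/-- `h₁ = diag(1, -1, 0)`. -/
def h₁ : Alg := elt 1 0 0 0 0 0 0 0

/-- `h₂ = diag(0, 1, -1)`. -/
def h₂ : Alg := elt 0 1 0 0 0 0 0 0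

/-- `x₁ = E₁₂`. -/
def x₁ : Alg := elt 0 0 1 0 0 0 0 0

/-- `x₂ = E₂₃`. -/
def x₂ : Alg := elt 0 0 0 1 0 0 0 0

/-- `x₃ = -E₁₃`. -/
def x₃ : Alg := elt 0 0 0 0 1 0 0 0

/-- `y₁ = E₂₁`. -/
def y₁ : Alg := elt 0 0 0 0 0 1 0 0

/-- `y₂ = E₃₂`. -/
def y₂ : Alg := elt 0 0 0 0 0 0 1 0

/-- `y₃ = -E₃₁`. -/
def y₃ : Alg := elt 0 0 0 0 0 0 0 1

/-- The Lie subalgebra of `sl(3, ℂ)` generated by three elements. -/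
def gen (u v w : Alg) : LieSubalgebra ℂ Alg := LieSubalgebra.lieSpan ℂ Alg {u, v, w}

/-- Labels of the subalgebras in the list. The label `L_i_j` stands for the `j`-th subalgebra of
type `L_i`; `family₁ α` and `family₂ α` stand for the two one-parameter families, with `α ≠ ±1`. -/
inductive Label : Type
  | L2_1
  | L2_2
  | L3_quarter_1
  | L3_quarter_2
  | L3_two_ninths
  | L3_zero
  | family₁ (α : ℂ) (h1 : α ≠ 1) (h2 : α ≠ -1)
  | family₂ (α : ℂ) (h1 : α ≠ 1) (h2 : α ≠ -1)
  | L4_1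
  | L4_2
  | L5_1

/-- The list of subalgebras of `sl(3, ℂ)`. -/
def subalg : Label → LieSubalgebra ℂ Alg
  | .L2_1 => gen x₁ x₃ ((2 : ℂ) • h₁ + h₂)
  | .L2_2 => gen x₁ y₂ (h₁ - h₂)
  | .L3_quarter_1 => gen x₁ x₃ ((2 : ℂ) • h₁ + h₂ + x₂)
  | .L3_quarter_2 => gen y₁ y₃ ((2 : ℂ) • h₁ + h₂ + x₂)
  | .L3_two_ninths => gen (x₁ + x₂) x₃ (h₁ + h₂)
  | .L3_zero => gen x₁ h₁ h₂
  | .family₁ α _ _ => gen x₁ x₃ ((α - 1) • h₁ + α • h₂)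
  | .family₂ α _ _ => gen x₁ y₂ (h₁ + α • h₂)
  | .L4_1 => gen x₁ x₃ h₂
  | .L4_2 => gen x₁ y₂ (h₁ + h₂)
  | .L5_1 => gen x₁ x₂ x₃

/-- The isomorphism type attached to each label. -/
def HasListedType (T : Type*) [LieRing T] [LieAlgebra ℂ T] : Label → Prop
  | .L2_1 => IsTypeL2 T
  | .L2_2 => IsTypeL2 T
  | .L3_quarter_1 => IsTypeL3 (-(1 / 4)) T
  | .L3_quarter_2 => IsTypeL3 (-(1 / 4)) T
  | .L3_two_ninths => IsTypeL3 (-(2 / 9)) T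
  | .L3_zero => IsTypeL3 0 T
  | .family₁ α _ _ => IsTypeL3 (-((2 * α - 1) * (α - 2) / (9 * (α - 1) ^ 2))) T
  | .family₂ α _ _ => IsTypeL3 (-((2 * α - 1) * (α - 2) / (9 * (α - 1) ^ 2))) T
  | .L4_1 => IsTypeL4 T
  | .L4_2 => IsTypeL4 T
  | .L5_1 => IsTypeL5 T

end A2

namespace A2

open Matrix

/-! Everything is reduced to simultaneous conjugation of matrices. An ad-nilpotent traceless `3 × 3`
matrix `x` has cube zero, and `exp (ad x)` is conjugation by `exp x`. Conversely, `GL₃(ℂ)` is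
generated modulo scalars by transvections, each the exponential of a square-zero matrix. Hence the
inner automorphisms are exactly the conjugations (`innerEquivalent_iff`).

Existence. By Lie's theorem a solvable subalgebra is conjugate to an upper triangular one
(`exists_triangular`). For a three-dimensional one, the space of diagonal parts has dimension 0, 1
or 2. Dimension 0 gives all strictly upper triangular matrices. In dimension 2, an element with
distinct eigenvalues can be diagonalized; its adjoint action splits the algebra into the full
diagonal and one root vector. In dimension 1, there are a two-dimensional space of strictly upper
triangular matrices, which always contains `E₁₃`, and one further element `s`. The other nilpotent
direction `p E₁₂ + q E₂₃` decides the type: a row (`q = 0`), a column (`p = 0`), or a regular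
nilpotent. For a row or a column, the Jordan form of the `2 × 2` block of `s` complementary to the
common image or common kernel gives the list.

Inequivalence. For the row types all nilpotent elements have image in one line, on which an element
`Y` acts by a scalar `c`. The ratio of `tr Y²` to `c²` is `2 (α² - α + 1) / (α - 1)²`, which
determines `α` up to `α ↦ 1/α`. The values `-1` and `1` missing from the family belong to `L2_1`,
`L3_quarter_1` and to `L4_1` (there `c = 0`). The column types are dual, with a common kernel plane.
A quadratic equation separates the two types at `-1`, and the nilpotent elements separate the three
remaining labels. -/

/-- Complex `3 × 3` matrices. -/
abbrev M3 : Type := Matrix (Fin 3) (Fin 3) ℂ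

theorem trace_coe (X : Alg) : Matrix.trace (X : M3) = 0 := X.2

/-- The element of `sl(3, ℂ)` given by a traceless matrix. -/
def ofMat (A : M3) (h : A.trace = 0) : Alg := ⟨A, h⟩

@[simp] theorem coe_ofMat (A : M3) (h : A.trace = 0) : ((ofMat A h : Alg) : M3) = A := rfl

theorem coe_lie (X Y : Alg) : ((⁅X, Y⁆ : Alg) : M3) = (X : M3) * Y - (Y : M3) * X := rfl

theorem coe_add (X Y : Alg) : ((X + Y : Alg) : M3) = (X : M3) + Y := rfl
theorem coe_sub (X Y : Alg) : ((X - Y : Alg) : M3) = (X : M3) - Y := rfl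
theorem coe_smul (c : ℂ) (X : Alg) : ((c • X : Alg) : M3) = c • (X : M3) := rfl
theorem coe_zero : ((0 : Alg) : M3) = 0 := rfl

/-! ### Conjugation by invertible matrices -/

/-- Conjugation by an invertible matrix, as an automorphism of `sl(3, ℂ)`. -/
def conj (P : M3ˣ) : Alg ≃ₗ⁅ℂ⁆ Alg where
  toFun X := ofMat (P * X * (P⁻¹ : M3ˣ)) (by
    rw [Matrix.trace_mul_comm, ← mul_assoc, Units.inv_mul, one_mul, trace_coe])
  invFun X := ofMat ((P⁻¹ : M3ˣ) * X * P) (by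
    rw [Matrix.trace_mul_comm, ← mul_assoc, Units.mul_inv, one_mul, trace_coe])
  map_add' X Y := Subtype.ext (by simp [coe_add, mul_add, add_mul])
  map_smul' c X := Subtype.ext (by simp)
  map_lie' {X Y} := Subtype.ext (by
    simp only [coe_lie, coe_ofMat, mul_sub, sub_mul]
    simp only [mul_assoc, Units.inv_mul_cancel_left])
  left_inv X := Subtype.ext (by
    simp only [coe_ofMat, mul_assoc, Units.inv_mul_cancel_left, Units.inv_mul, mul_one])
  right_inv X := Subtype.ext (by
    simp only [coe_ofMat, mul_assoc, Units.mul_inv_cancel_left, Units.mul_inv, mul_one])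

theorem coe_conj (P : M3ˣ) (X : Alg) : (conj P X : M3) = P * X * (P⁻¹ : M3ˣ) := rfl

theorem conj_eq_iff (P : M3ˣ) (X Y : Alg) : conj P X = Y ↔ (P : M3) * X = Y * P := by
  rw [← Units.mul_inv_eq_iff_eq_mul]
  exact Subtype.ext_iff

theorem conj_one : conj 1 = LieEquiv.refl := by
  ext1 X; exact (conj_eq_iff 1 X X).2 (by simp)

theorem conj_mul (P Q : M3ˣ) : conj (P * Q) = (conj Q).trans (conj P) := by
  ext1 X
  apply Subtype.ext
  simp [coe_conj, mul_assoc]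

theorem conj_inv (P : M3ˣ) : conj P⁻¹ = (conj P).symm := by
  ext1 X
  have h : conj P (conj P⁻¹ X) = X := Subtype.ext (by simp [coe_conj, mul_assoc])
  rw [← h, LieEquiv.symm_apply_apply, h]

/-! ### Inner automorphisms are conjugations -/

theorem coe_ad_pow_eigen {x y : Alg} {c : ℂ} (h : ⁅x, y⁆ = c • y) (n : ℕ) :
    ((LieAlgebra.ad ℂ Alg x) ^ n) y = c ^ n • y := by
  induction n with
  | zero => simp
  | succ n ih => rw [pow_succ', Module.End.mul_apply, ih, map_smul, LieAlgebra.ad_apply, h,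
      smul_smul, pow_succ]

/-- A right eigenvector `v` for `r` and a left eigenvector `w` for `s` give a rank-one matrix `v wᵀ`
on which `ad x` acts by `r - s`. Nilpotency kills this eigenvalue. -/
theorem eigenvalues_eq_of_ad_nilpotent {x : Alg} {n : ℕ} (hx : (LieAlgebra.ad ℂ Alg x) ^ n = 0)
    {r s : ℂ} (hr : (x : M3).charpoly.IsRoot r) (hs : (x : M3).charpoly.IsRoot s) : r = s := by
  by_contra hrs
  have det0 : ∀ t : ℂ, (x : M3).charpoly.IsRoot t → (scalar (Fin 3) t - (x : M3)).det = 0 := by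
    intro t ht
    rwa [Polynomial.IsRoot, Matrix.eval_charpoly] at ht
  obtain ⟨v, hv0, hv⟩ := Matrix.exists_mulVec_eq_zero_iff.2 (det0 r hr)
  obtain ⟨w, hw0, hw⟩ := Matrix.exists_vecMul_eq_zero_iff.2 (det0 s hs)
  have hv' : (x : M3) *ᵥ v = r • v := by
    rw [Matrix.sub_mulVec, sub_eq_zero] at hv
    rw [← hv]; simp [← Matrix.smul_one_eq_diagonal, Matrix.smul_mulVec]
  have hw' : w ᵥ* (x : M3) = s • w := by
    rw [Matrix.vecMul_sub, sub_eq_zero] at hw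
    rw [← hw]; simp [← Matrix.smul_one_eq_diagonal, Matrix.vecMul_smul]
  have h1 : (x : M3) * vecMulVec v w = r • vecMulVec v w := by
    rw [Matrix.mul_vecMulVec, hv', Matrix.smul_vecMulVec]
  have h2 : vecMulVec v w * (x : M3) = s • vecMulVec v w := by
    rw [Matrix.vecMulVec_mul, hw', Matrix.vecMulVec_smul]
  -- The rank-one matrix must lie in `sl(3, ℂ)`; for `r ≠ s` cyclicity of the trace forces this.
  have htr : (vecMulVec v w).trace = 0 := by
    have := Matrix.trace_mul_comm (x : M3) (vecMulVec v w)
    rw [h1, h2, Matrix.trace_smul, Matrix.trace_smul, smul_eq_mul, smul_eq_mul, ← sub_eq_zero,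
      ← sub_mul] at this
    exact (mul_eq_zero.1 this).resolve_left (sub_ne_zero.2 hrs)
  have hlie : ⁅x, ofMat _ htr⁆ = (r - s) • ofMat _ htr := Subtype.ext (by
    rw [coe_lie, coe_smul, coe_ofMat, h1, h2, sub_smul])
  have := coe_ad_pow_eigen hlie n
  rw [hx, LinearMap.zero_apply, eq_comm, smul_eq_zero] at this
  rcases this with h | h
  · exact hrs (sub_eq_zero.1 (eq_zero_of_pow_eq_zero h))
  · obtain ⟨i, hi⟩ := Function.ne_iff.1 hv0
    obtain ⟨j, hj⟩ := Function.ne_iff.1 hw0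
    have := congrFun (congrFun (congrArg (fun Y : Alg => (Y : M3)) h) i) j
    simp only [coe_ofMat, coe_zero, Matrix.vecMulVec_apply, Matrix.zero_apply, mul_eq_zero] at this
    exact this.elim hi hj

/-- The only eigenvalue has multiplicity three and trace zero makes it vanish, so Cayley–Hamilton
applies with characteristic polynomial `X ^ 3`. -/
theorem pow_three_of_ad_nilpotent {x : Alg} {n : ℕ} (hx : (LieAlgebra.ad ℂ Alg x) ^ n = 0) :
    (x : M3) ^ 3 = 0 := by
  have hsplit : (x : M3).charpoly.Splits := IsAlgClosed.splits _
  have hcard : (x : M3).charpoly.roots.card = 3 := by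
    rw [← hsplit.natDegree_eq_card_roots, Matrix.charpoly_natDegree_eq_dim, Fintype.card_fin]
  have hne : (x : M3).charpoly ≠ 0 := (Matrix.charpoly_monic _).ne_zero
  obtain ⟨r, hr⟩ := Multiset.card_pos_iff_exists_mem.1 (by omega : 0 < (x : M3).charpoly.roots.card)
  have hrep : (x : M3).charpoly.roots = Multiset.replicate 3 r :=
    Multiset.eq_replicate.2 ⟨hcard, fun s hs => eigenvalues_eq_of_ad_nilpotent hx
      ((Polynomial.mem_roots hne).1 hs) ((Polynomial.mem_roots hne).1 hr)⟩
  have htr := Matrix.trace_eq_sum_roots_charpoly (x : M3)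
  rw [trace_coe, hrep] at htr
  have hr0 : r = 0 := by
    simp only [Multiset.sum_replicate, nsmul_eq_mul] at htr
    simpa using htr.symm
  have hch : (x : M3).charpoly = Polynomial.X ^ 3 := by
    rw [hsplit.eq_prod_roots_of_monic (Matrix.charpoly_monic _), hrep, hr0]
    simp [pow_three]
  have := Matrix.aeval_self_charpoly (x : M3)
  rwa [hch, map_pow, Polynomial.aeval_X] at this

/-- The exponential of a matrix of vanishing cube. -/
noncomputable def expUnit (x : M3) (hx : x ^ 3 = 0) : M3ˣ where
  val := 1 + x + (2⁻¹ : ℂ) • (x * x)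
  inv := 1 - x + (2⁻¹ : ℂ) • (x * x)
  val_inv := by
    have h3 : x * (x * x) = 0 := by rw [← hx, pow_three]
    simp only [mul_add, add_mul, mul_sub, one_mul, mul_one, smul_mul_assoc,
      mul_smul_comm, mul_assoc, h3, mul_zero, smul_zero]
    match_scalars <;> norm_num
  inv_val := by
    have h3 : x * (x * x) = 0 := by rw [← hx, pow_three]
    simp only [mul_add, add_mul, sub_mul, one_mul, mul_one, smul_mul_assoc,
      mul_smul_comm, mul_assoc, h3, mul_zero, smul_zero]
    match_scalars <;> norm_num

/-- `ad x` is the difference of the commuting left and right multiplications by `x`, both of cube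
zero; every term of the fifth power contains one of them at least three times. -/
theorem ad_pow_five {x : Alg} (hx : (x : M3) ^ 3 = 0) : (LieAlgebra.ad ℂ Alg x) ^ 5 = 0 := by
  have h3 : (x : M3) * (x * x) = 0 := by rw [← hx, pow_three]
  have h3' : ∀ z : M3, (x : M3) * (x * (x * z)) = 0 := fun z => by
    rw [← mul_assoc, ← mul_assoc, mul_assoc (x : M3), h3, zero_mul]
  ext1 y
  apply Subtype.ext
  simp only [pow_succ, pow_zero, one_mul, Module.End.mul_apply, LieAlgebra.ad_apply, coe_lie,
    LinearMap.zero_apply, coe_zero, mul_sub, sub_mul, mul_assoc, h3, h3', mul_zero]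
  simp

theorem sum_ad_eq_conj {x : Alg} (hx : (x : M3) ^ 3 = 0) (y : Alg) :
    ∑ i ∈ Finset.range 5, ((i.factorial : ℂ)⁻¹) • ((LieAlgebra.ad ℂ Alg x) ^ i) y =
      conj (expUnit x hx) y := by
  have h3 : (x : M3) * (x * x) = 0 := by rw [← hx, pow_three]
  have h3' : ∀ z : M3, (x : M3) * (x * (x * z)) = 0 := fun z => by
    rw [← mul_assoc, ← mul_assoc, mul_assoc (x : M3), h3, zero_mul]
  apply Subtype.ext
  have hinv : (((expUnit x hx)⁻¹ : M3ˣ) : M3) = 1 - x + (2⁻¹ : ℂ) • ((x : M3) * x) := rfl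
  have hval : ((expUnit x hx : M3ˣ) : M3) = 1 + x + (2⁻¹ : ℂ) • ((x : M3) * x) := rfl
  rw [coe_conj, hinv, hval]
  simp only [Finset.sum_range_succ, Finset.sum_range_zero, coe_add, coe_smul, coe_zero,
    pow_succ, pow_zero, one_mul, Module.End.mul_apply, Module.End.one_apply,
    LieAlgebra.ad_apply, coe_lie, mul_add, add_mul, mul_one,
    mul_sub, sub_mul, mul_assoc, h3, h3', mul_zero, smul_mul_assoc, mul_smul_comm, Nat.factorial]
  match_scalars <;> norm_num

theorem exists_conj_of_isInnerAut {φ : Alg ≃ₗ⁅ℂ⁆ Alg} (h : IsInnerAut φ) :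
    ∃ P : M3ˣ, φ = conj P := by
  induction h with
  | exp_ad x n hx φ hφ =>
    have h3 := pow_three_of_ad_nilpotent hx
    refine ⟨expUnit x h3, ?_⟩
    ext1 y
    rw [hφ, ← sum_ad_eq_conj]
    -- The exponent `n` in the definition is arbitrary, whereas conjugation was computed with five
    -- terms; both sums are extended by vanishing terms to length `max n 5`.
    have key : ∀ m k : ℕ, (LieAlgebra.ad ℂ Alg x) ^ m = 0 → m ≤ k →
        ∑ i ∈ Finset.range m, ((i.factorial : ℂ)⁻¹) • ((LieAlgebra.ad ℂ Alg x) ^ i) y =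
        ∑ i ∈ Finset.range k, ((i.factorial : ℂ)⁻¹) • ((LieAlgebra.ad ℂ Alg x) ^ i) y := by
      intro m k hm hmk
      refine Finset.sum_subset (by simpa using hmk) fun i _ hi => ?_
      rw [pow_eq_zero_of_le (by simpa using hi) hm, LinearMap.zero_apply, smul_zero]
    rw [key n (max n 5) hx (le_max_left _ _), key 5 (max n 5) (ad_pow_five h3) (le_max_right _ _)]
  | refl => exact ⟨1, conj_one.symm⟩
  | symm φ _ ih =>
    obtain ⟨P, rfl⟩ := ih
    exact ⟨P⁻¹, (conj_inv P).symm⟩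
  | trans φ ψ _ _ ih₁ ih₂ =>
    obtain ⟨P, rfl⟩ := ih₁
    obtain ⟨Q, rfl⟩ := ih₂
    exact ⟨Q * P, (conj_mul Q P).symm⟩

/-! ### Conjugations are inner automorphisms -/

/-- Conjugation by any unit with underlying matrix `A` is inner. -/
def ConjInner (A : M3) : Prop := ∀ P : M3ˣ, (P : M3) = A → IsInnerAut (conj P)

theorem ConjInner.mul {A B : M3} (hA : ConjInner A) (hB : ConjInner B)
    (hAd : A.det ≠ 0) (hBd : B.det ≠ 0) : ConjInner (A * B) := by
  intro P hP
  have h : P = Matrix.GeneralLinearGroup.mkOfDetNeZero A hAd *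
      Matrix.GeneralLinearGroup.mkOfDetNeZero B hBd := Units.ext hP
  rw [h, conj_mul]
  exact .trans _ _ (hB _ rfl) (hA _ rfl)

theorem ConjInner.smul {A : M3} (hA : ConjInner A) {c : ℂ} (hc : c ≠ 0) : ConjInner (c • A) := by
  intro P hP
  have hu : IsUnit A := by
    have : A = c⁻¹ • (P : M3) := by rw [hP, smul_smul, inv_mul_cancel₀ hc, one_smul]
    rw [this]
    exact (Units.mk0 c⁻¹ (inv_ne_zero hc) • P).isUnit
  obtain ⟨Q, rfl⟩ := hu
  have : conj P = conj Q := by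
    ext1 X
    rw [conj_eq_iff, coe_conj, hP]
    simp [mul_assoc]
  rw [this]
  exact hA Q rfl

theorem conjInner_one_add {A : M3} (hA : A * A = 0) (htr : A.trace = 0) : ConjInner (1 + A) := by
  intro P hP
  have h3 : ((ofMat A htr : Alg) : M3) ^ 3 = 0 := by rw [pow_three, coe_ofMat, hA, mul_zero]
  have : P = expUnit _ h3 := Units.ext (by rw [hP]; simp [expUnit, hA])
  rw [this]
  exact .exp_ad _ 5 (ad_pow_five h3) _ fun y => (sum_ad_eq_conj h3 y).symm

theorem conjInner_transvection {i j : Fin 3} (hij : i ≠ j) (c : ℂ) :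
    ConjInner (transvection i j c) := by
  refine conjInner_one_add ?_ ?_
  · rw [Matrix.single_mul_single_of_ne _ _ _ _ hij.symm]
  · exact Matrix.trace_single_eq_of_ne _ _ _ hij

theorem conjInner_transvections (L : List (TransvectionStruct (Fin 3) ℂ)) :
    ConjInner (L.map TransvectionStruct.toMatrix).prod := by
  induction L with
  | nil =>
    intro P hP
    rw [show P = 1 from Units.ext (by simpa using hP), conj_one]
    exact .refl
  | cons t L ih =>
    rw [List.map_cons, List.prod_cons]
    refine (conjInner_transvection t.hij t.c).mul ih ?_ ?_
    · rw [Matrix.det_transvection_of_ne _ _ t.hij]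
      exact one_ne_zero
    · rw [TransvectionStruct.det_toMatrix_prod]
      exact one_ne_zero

theorem conjInner_diag₁ {t : ℂ} (ht : t ≠ 0) : ConjInner (diagonal ![t, t⁻¹, 1]) := by
  have h01 : (0 : Fin 3) ≠ 1 := by decide
  -- The classical factorization `h(t) = w(t) w(-1)` in `SL₂`, where `w(t)` is the product of the
  -- elementary matrices with parameters `t`, `-t⁻¹`, `t`.
  have := conjInner_transvections [⟨0, 1, h01, t⟩, ⟨1, 0, h01.symm, -t⁻¹⟩, ⟨0, 1, h01, t⟩,
    ⟨0, 1, h01, -1⟩, ⟨1, 0, h01.symm, 1⟩, ⟨0, 1, h01, -1⟩]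
  convert this using 1
  ext i j
  fin_cases i <;> fin_cases j <;>
    simp [TransvectionStruct.toMatrix, transvection, Matrix.mul_apply, Fin.sum_univ_three,
      Matrix.single, ht, Matrix.add_apply]

theorem conjInner_diag₂ {t : ℂ} (ht : t ≠ 0) : ConjInner (diagonal ![1, t, t⁻¹]) := by
  have h12 : (1 : Fin 3) ≠ 2 := by decide
  have := conjInner_transvections [⟨1, 2, h12, t⟩, ⟨2, 1, h12.symm, -t⁻¹⟩, ⟨1, 2, h12, t⟩,
    ⟨1, 2, h12, -1⟩, ⟨2, 1, h12.symm, 1⟩, ⟨1, 2, h12, -1⟩]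
  convert this using 1
  ext i j
  fin_cases i <;> fin_cases j <;>
    simp [TransvectionStruct.toMatrix, transvection, Matrix.mul_apply, Fin.sum_univ_three,
      Matrix.single, ht, Matrix.add_apply]

theorem conjInner_diagonal {D : Fin 3 → ℂ} (hD : (diagonal D).det ≠ 0) :
    ConjInner (diagonal D) := by
  rw [Matrix.det_diagonal, Fin.prod_univ_three] at hD
  obtain ⟨r, hr⟩ := IsAlgClosed.exists_pow_nat_eq (D 0 * D 1 * D 2) (n := 3) (by norm_num)
  have hr0 : r ≠ 0 := by rintro rfl; exact hD (by rw [← hr]; norm_num)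
  have h0 : D 0 ≠ 0 := by intro h; simp [h] at hD
  have h2 : D 2 ≠ 0 := by intro h; simp [h] at hD
  have ht : D 0 / r ≠ 0 := div_ne_zero h0 hr0
  have hs : r / D 2 ≠ 0 := div_ne_zero hr0 h2
  -- With `r` a cube root of the determinant, the matrix is `r` times a diagonal matrix of
  -- determinant one; scalars do not affect conjugation.
  have key := ((conjInner_diag₁ ht).mul (conjInner_diag₂ hs)
    (by simp [Matrix.det_diagonal, Fin.prod_univ_three, h0, hr0])
    (by simp [Matrix.det_diagonal, Fin.prod_univ_three, h2, hr0])).smul hr0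
  convert key using 1
  rw [Matrix.diagonal_mul_diagonal, ← Matrix.diagonal_smul]
  congr 1
  ext i
  fin_cases i
  · simp; field_simp
  · simp
    field_simp
    linear_combination -hr
  · simp; field_simp

theorem isInnerAut_conj (P : M3ˣ) : IsInnerAut (conj P) := by
  have hdet : (P : M3).det ≠ 0 := (Matrix.isUnit_iff_isUnit_det _).1 P.isUnit |>.ne_zero
  exact Matrix.diagonal_transvection_induction_of_det_ne_zero ConjInner P hdet
    (fun D hD => conjInner_diagonal hD) (fun t => conjInner_transvection t.hij t.c)
    (fun A B hA hB h₁ h₂ => h₁.mul h₂ hA hB) P rfl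

theorem innerEquivalent_iff {K K' : LieSubalgebra ℂ Alg} :
    InnerEquivalent K K' ↔ ∃ P : M3ˣ, K.map (conj P : Alg →ₗ⁅ℂ⁆ Alg) = K' := by
  constructor
  · rintro ⟨φ, hφ, h⟩
    obtain ⟨P, rfl⟩ := exists_conj_of_isInnerAut hφ
    exact ⟨P, h⟩
  · rintro ⟨P, h⟩
    exact ⟨conj P, isInnerAut_conj P, h⟩

/-! ### Three-dimensional algebras with an abelian ideal of dimension two -/

/-- The derived algebra lies in the span of `z 0` and `z 1`, which is abelian. -/
theorem isSolvable_of_basis {T : Type*} [LieRing T] [LieAlgebra ℂ T] (z : Module.Basis (Fin 3) ℂ T)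
    {p q r s : ℂ} (h20 : ⁅z 2, z 0⁆ = p • z 0 + q • z 1) (h21 : ⁅z 2, z 1⁆ = r • z 0 + s • z 1)
    (h01 : ⁅z 0, z 1⁆ = 0) : LieAlgebra.IsSolvable T := by
  have hexp : ∀ x : T, x = z.coord 0 x • z 0 + z.coord 1 x • z 1 + z.coord 2 x • z 2 := fun x => by
    have := (z.sum_repr x).symm
    rwa [Fin.sum_univ_three] at this
  have h10 : ⁅z 1, z 0⁆ = 0 := by rw [← lie_skew, h01, neg_zero]
  have h02 : ⁅z 0, z 2⁆ = -(p • z 0 + q • z 1) := by rw [← lie_skew, h20]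
  have h12 : ⁅z 1, z 2⁆ = -(r • z 0 + s • z 1) := by rw [← lie_skew, h21]
  have hbr : ∀ x y : T, z.coord 2 ⁅x, y⁆ = 0 := fun x y => by
    rw [hexp x, hexp y]
    simp [h20, h21, h01, h10, h02, h12]
  let J : LieIdeal ℂ T := { LinearMap.ker (z.coord 2) with lie_mem := fun {x y} _ => hbr x y }
  have hJ : ∀ x ∈ J, z.coord 2 x = 0 := fun x hx => hx
  have h1 : LieAlgebra.derivedSeries ℂ T 1 ≤ J := by
    rw [LieAlgebra.derivedSeries_def, LieAlgebra.derivedSeriesOfIdeal_succ, LieSubmodule.lie_le_iff]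
    exact fun x _ y _ => hbr x y
  have h2 : LieAlgebra.derivedSeries ℂ T 2 = ⊥ := by
    rw [eq_bot_iff, LieAlgebra.derivedSeries_def, LieAlgebra.derivedSeriesOfIdeal_succ,
      LieSubmodule.lie_le_iff]
    intro x hx y hy
    rw [LieSubmodule.mem_bot, hexp x, hexp y, hJ x (h1 hx), hJ y (h1 hy)]
    simp [h01, h10]
  exact LieAlgebra.IsSolvable.mk h2

/-- The brackets show that the linear span of `z` is already closed under the Lie bracket, so it
equals the generated subalgebra. -/
theorem gen_eq {u v w : Alg} (z : Fin 3 → Alg) {p q r s : ℂ}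
    (hz : LinearIndependent ℂ z)
    (h20 : ⁅z 2, z 0⁆ = p • z 0 + q • z 1) (h21 : ⁅z 2, z 1⁆ = r • z 0 + s • z 1)
    (h01 : ⁅z 0, z 1⁆ = 0)
    (hspan : Submodule.span ℂ (Set.range z) = Submodule.span ℂ {u, v, w}) :
    (∃ b : Module.Basis (Fin 3) ℂ (gen u v w), ∀ i, (b i : Alg) = z i) ∧
      LieAlgebra.IsSolvable (gen u v w) ∧
      ∀ X, X ∈ gen u v w ↔ ∃ a b c : ℂ, X = a • u + b • v + c • w := by
  have h10 : ⁅z 1, z 0⁆ = 0 := by rw [← lie_skew, h01, neg_zero]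
  have h02 : ⁅z 0, z 2⁆ = -(p • z 0 + q • z 1) := by rw [← lie_skew, h20]
  have h12 : ⁅z 1, z 2⁆ = -(r • z 0 + s • z 1) := by rw [← lie_skew, h21]
  have hmem : ∀ X, X ∈ Submodule.span ℂ (Set.range z) ↔
      ∃ a b c : ℂ, a • z 0 + b • z 1 + c • z 2 = X := fun X => by
    rw [Submodule.mem_span_range_iff_exists_fun]
    constructor
    · rintro ⟨f, rfl⟩
      exact ⟨f 0, f 1, f 2, by rw [Fin.sum_univ_three]⟩
    · rintro ⟨a, b, c, rfl⟩
      exact ⟨![a, b, c], by simp [Fin.sum_univ_three]⟩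
  let S : LieSubalgebra ℂ Alg :=
    { Submodule.span ℂ (Set.range z) with
      lie_mem' := by
        intro X Y hX hY
        obtain ⟨a, b, c, rfl⟩ := (hmem X).1 hX
        obtain ⟨a', b', c', rfl⟩ := (hmem Y).1 hY
        refine (hmem _).2 ⟨c * a' * p - a * c' * p + c * b' * r - b * c' * r,
          c * a' * q - a * c' * q + c * b' * s - b * c' * s, 0, ?_⟩
        simp only [add_lie, lie_add, smul_lie, lie_smul, h20, h21, h01, h10, h02, h12, lie_self]
        module }
  have hS : gen u v w = S := by
    apply le_antisymm
    · refine LieSubalgebra.lieSpan_le.2 fun X hX => ?_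
      change X ∈ Submodule.span ℂ (Set.range z)
      rw [hspan]
      exact Submodule.subset_span hX
    · intro X hX
      change X ∈ Submodule.span ℂ (Set.range z) at hX
      rw [hspan] at hX
      exact LieSubalgebra.submodule_span_le_lieSpan hX
  have hb : ∃ b : Module.Basis (Fin 3) ℂ (gen u v w), ∀ i, (b i : Alg) = z i := by
    rw [hS]
    exact ⟨Module.Basis.span hz, fun i => congrArg Subtype.val (Module.Basis.span_apply hz i)⟩
  refine ⟨hb, ?_, fun X => ?_⟩
  · obtain ⟨b, hb⟩ := hb
    refine isSolvable_of_basis b (p := p) (q := q) (r := r) (s := s) ?_ ?_ ?_ <;>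
    · apply Subtype.ext
      simpa [hb]
  · rw [hS]
    change X ∈ Submodule.span ℂ (Set.range z) ↔ _
    rw [hspan, Submodule.mem_span_triple]
    simp only [eq_comm]

/-! ### Computing with coordinates -/

theorem coe_elt (a b c d e c' d' e' : ℂ) :
    (elt a b c d e c' d' e' : M3) = !![a, c, -e; c', b - a, d; -e', d', -b] := rfl

theorem elt_add (a b c d e f g h a' b' c' d' e' f' g' h' : ℂ) :
    elt a b c d e f g h + elt a' b' c' d' e' f' g' h' =
      elt (a + a') (b + b') (c + c') (d + d') (e + e') (f + f') (g + g') (h + h') := by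
  apply Subtype.ext
  rw [coe_add, coe_elt, coe_elt, coe_elt]
  ext i j
  fin_cases i <;> fin_cases j <;> simp <;> ring

theorem elt_smul (t a b c d e f g h : ℂ) :
    t • elt a b c d e f g h =
      elt (t * a) (t * b) (t * c) (t * d) (t * e) (t * f) (t * g) (t * h) := by
  apply Subtype.ext
  rw [coe_smul, coe_elt, coe_elt]
  ext i j
  fin_cases i <;> fin_cases j <;> simp <;> ring

theorem elt_sub (a b c d e f g h a' b' c' d' e' f' g' h' : ℂ) :
    elt a b c d e f g h - elt a' b' c' d' e' f' g' h' =
      elt (a - a') (b - b') (c - c') (d - d') (e - e') (f - f') (g - g') (h - h') := by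
  apply Subtype.ext
  rw [coe_sub, coe_elt, coe_elt, coe_elt]
  ext i j
  fin_cases i <;> fin_cases j <;> simp <;> ring

theorem elt_lie (a b c d e f g h a' b' c' d' e' f' g' h' : ℂ) :
    ⁅elt a b c d e f g h, elt a' b' c' d' e' f' g' h'⁆ =
      elt (c * f' + e * h' - c' * f - e' * h) (d * g' + e * h' - d' * g - e' * h)
        (a * c' + c * (b' - a') - e * g' - a' * c - c' * (b - a) + e' * g)
        (-f * e' + (b - a) * d' - d * b' + f' * e - (b' - a') * d + d' * b)
        (a * e' - c * d' - e * b' - a' * e + c' * d + e' * b)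
        (f * a' + (b - a) * f' - d * h' - f' * a - (b' - a') * f + d' * h)
        (-h * c' + g * (b' - a') - b * g' + h' * c - g' * (b - a) + b' * g)
        (h * a' - g * f' - b * h' - h' * a + g' * f + b' * h) := by
  apply Subtype.ext
  rw [coe_lie, coe_elt, coe_elt, coe_elt]
  ext i j
  fin_cases i <;> fin_cases j <;> simp <;> ring

theorem elt_zero : elt 0 0 0 0 0 0 0 0 = 0 := by
  apply Subtype.ext
  rw [coe_elt, coe_zero]
  ext i j
  fin_cases i <;> fin_cases j <;> simp

theorem elt_inj {a b c d e f g h a' b' c' d' e' f' g' h' : ℂ} :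
    elt a b c d e f g h = elt a' b' c' d' e' f' g' h' ↔
      a = a' ∧ b = b' ∧ c = c' ∧ d = d' ∧ e = e' ∧ f = f' ∧ g = g' ∧ h = h' := by
  constructor
  · intro H
    have H' : ∀ i j, (elt a b c d e f g h : M3) i j = (elt a' b' c' d' e' f' g' h' : M3) i j :=
      fun i j => by rw [H]
    simp only [coe_elt] at H'
    have h00 := H' 0 0
    have h01 := H' 0 1
    have h02 := H' 0 2
    have h10 := H' 1 0
    have h12 := H' 1 2
    have h20 := H' 2 0
    have h21 := H' 2 1
    have h22 := H' 2 2
    simp at h00 h01 h02 h10 h12 h20 h21 h22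
    exact ⟨h00, h22, h01, h12, h02, h10, h21, h20⟩
  · rintro ⟨rfl, rfl, rfl, rfl, rfl, rfl, rfl, rfl⟩
    rfl

theorem exists_elt (X : Alg) : ∃ a b c d e f g h : ℂ, X = elt a b c d e f g h := by
  have htr := trace_coe X
  rw [Matrix.trace_fin_three] at htr
  refine ⟨(X : M3) 0 0, -(X : M3) 2 2, (X : M3) 0 1, (X : M3) 1 2, -(X : M3) 0 2, (X : M3) 1 0,
    (X : M3) 2 1, -(X : M3) 2 0, Subtype.ext ?_⟩
  rw [coe_elt]
  ext i j
  fin_cases i <;> fin_cases j <;> simp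
  linear_combination htr

theorem linearIndependent_triple {z : Fin 3 → Alg}
    (h : ∀ a b c : ℂ, a • z 0 + b • z 1 + c • z 2 = 0 → a = 0 ∧ b = 0 ∧ c = 0) :
    LinearIndependent ℂ z := by
  rw [Fintype.linearIndependent_iff]
  intro g hg
  rw [Fin.sum_univ_three] at hg
  obtain ⟨h0, h1, h2⟩ := h _ _ _ hg
  intro i
  fin_cases i <;> assumption

theorem span_range_eq_span_triple {u v w : Alg} {z : Fin 3 → Alg}
    (hz : ∀ i, ∃ a b c : ℂ, a • u + b • v + c • w = z i)
    (hu : ∃ a b c : ℂ, a • z 0 + b • z 1 + c • z 2 = u)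
    (hv : ∃ a b c : ℂ, a • z 0 + b • z 1 + c • z 2 = v)
    (hw : ∃ a b c : ℂ, a • z 0 + b • z 1 + c • z 2 = w) :
    Submodule.span ℂ (Set.range z) = Submodule.span ℂ {u, v, w} := by
  have key : ∀ X, (∃ a b c : ℂ, a • z 0 + b • z 1 + c • z 2 = X) →
      X ∈ Submodule.span ℂ (Set.range z) := by
    rintro X ⟨a, b, c, rfl⟩
    exact add_mem (add_mem (Submodule.smul_mem _ _ (Submodule.subset_span ⟨0, rfl⟩))
      (Submodule.smul_mem _ _ (Submodule.subset_span ⟨1, rfl⟩)))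
      (Submodule.smul_mem _ _ (Submodule.subset_span ⟨2, rfl⟩))
  apply le_antisymm
  · rw [Submodule.span_le]
    rintro _ ⟨i, rfl⟩
    exact Submodule.mem_span_triple.2 (hz i)
  · rw [Submodule.span_le]
    rintro X (rfl | rfl | rfl)
    exacts [key _ hu, key _ hv, key _ hw]

/-! ### The listed subalgebras -/

set_option linter.unusedSimpArgs false

/-- The witnesses used below for types `L₃` and `L₄` follow one pattern: `z₀` is a cyclic vector for
`ad z₂` on a two-dimensional abelian ideal and `z₁ = [z₂, z₀]`. In type `L_{3,a}` the element `z₂`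
is scaled so that `ad z₂` has trace one there; then `-a` is its determinant. -/
theorem gen_spec {u v w : Alg} (z₀ z₁ z₂ : Alg) (p q r s : ℂ)
    (hz : ∀ a b c : ℂ, a • z₀ + b • z₁ + c • z₂ = elt 0 0 0 0 0 0 0 0 → a = 0 ∧ b = 0 ∧ c = 0)
    (h20 : ⁅z₂, z₀⁆ = p • z₀ + q • z₁) (h21 : ⁅z₂, z₁⁆ = r • z₀ + s • z₁)
    (h01 : ⁅z₀, z₁⁆ = elt 0 0 0 0 0 0 0 0)
    (h₀ : ∃ a b c : ℂ, a • u + b • v + c • w = z₀)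
    (h₁ : ∃ a b c : ℂ, a • u + b • v + c • w = z₁)
    (h₂ : ∃ a b c : ℂ, a • u + b • v + c • w = z₂)
    (hu : ∃ a b c : ℂ, a • z₀ + b • z₁ + c • z₂ = u)
    (hv : ∃ a b c : ℂ, a • z₀ + b • z₁ + c • z₂ = v)
    (hw : ∃ a b c : ℂ, a • z₀ + b • z₁ + c • z₂ = w) :
    (∃ b : Module.Basis (Fin 3) ℂ (gen u v w), ⁅b 2, b 0⁆ = p • b 0 + q • b 1 ∧
      ⁅b 2, b 1⁆ = r • b 0 + s • b 1 ∧ ⁅b 0, b 1⁆ = 0) ∧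
      LieAlgebra.IsSolvable (gen u v w) ∧
      ∀ X, X ∈ gen u v w ↔ ∃ a b c : ℂ, X = a • u + b • v + c • w := by
  rw [elt_zero] at h01 hz
  obtain ⟨⟨b, hb⟩, hs, hm⟩ := gen_eq ![z₀, z₁, z₂] (linearIndependent_triple hz) h20 h21 h01
    (span_range_eq_span_triple (fun i => by fin_cases i <;> assumption) hu hv hw)
  refine ⟨⟨b, ?_, ?_, ?_⟩, hs, hm⟩ <;>
  · apply Subtype.ext
    simpa [hb]

theorem spec_L2_1 :
    (∃ b : Module.Basis (Fin 3) ℂ (subalg .L2_1), ⁅b 2, b 0⁆ = (1 : ℂ) • b 0 + (0 : ℂ) • b 1 ∧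
      ⁅b 2, b 1⁆ = (0 : ℂ) • b 0 + (1 : ℂ) • b 1 ∧
      ⁅b 0, b 1⁆ = 0) ∧
      LieAlgebra.IsSolvable (subalg .L2_1) ∧
      ∀ X, X ∈ subalg .L2_1 ↔
        ∃ a b c : ℂ, X = a • x₁ + b • x₃ + c • ((2 : ℂ) • h₁ + h₂) := by
  refine gen_spec (elt 0 0 1 0 0 0 0 0) (elt 0 0 0 0 1 0 0 0)
    (elt (2 / 3) (1 / 3) 0 0 0 0 0 0) 1 0 0 1 ?_ ?_ ?_ ?_
    ⟨1, 0, 0, ?_⟩ ⟨0, 1, 0, ?_⟩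
    ⟨0, 0, 1 / 3, ?_⟩ ⟨1, 0, 0, ?_⟩
    ⟨0, 1, 0, ?_⟩ ⟨0, 0, 3, ?_⟩
  · intro a b c
    simp only [elt_add, elt_smul, elt_inj]
    grind
  all_goals
    simp only [elt_add, elt_sub, elt_smul, elt_lie, elt_inj, x₁, x₂, x₃, y₁, y₂, y₃, h₁, h₂]
    norm_num

theorem spec_L2_2 :
    (∃ b : Module.Basis (Fin 3) ℂ (subalg .L2_2), ⁅b 2, b 0⁆ = (1 : ℂ) • b 0 + (0 : ℂ) • b 1 ∧
      ⁅b 2, b 1⁆ = (0 : ℂ) • b 0 + (1 : ℂ) • b 1 ∧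
      ⁅b 0, b 1⁆ = 0) ∧
      LieAlgebra.IsSolvable (subalg .L2_2) ∧
      ∀ X, X ∈ subalg .L2_2 ↔
        ∃ a b c : ℂ, X = a • x₁ + b • y₂ + c • (h₁ - h₂) := by
  refine gen_spec (elt 0 0 1 0 0 0 0 0) (elt 0 0 0 0 0 0 1 0)
    (elt (1 / 3) (-(1 / 3)) 0 0 0 0 0 0) 1 0 0 1 ?_ ?_ ?_ ?_
    ⟨1, 0, 0, ?_⟩ ⟨0, 1, 0, ?_⟩
    ⟨0, 0, 1 / 3, ?_⟩ ⟨1, 0, 0, ?_⟩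
    ⟨0, 1, 0, ?_⟩ ⟨0, 0, 3, ?_⟩
  · intro a b c
    simp only [elt_add, elt_smul, elt_inj]
    grind
  all_goals
    simp only [elt_add, elt_sub, elt_smul, elt_lie, elt_inj, x₁, x₂, x₃, y₁, y₂, y₃, h₁, h₂]
    norm_num

theorem spec_L3_quarter_1 :
    (∃ b : Module.Basis (Fin 3) ℂ (subalg .L3_quarter_1), ⁅b 2, b 0⁆ = (0 : ℂ) • b 0 + (1 : ℂ) • b 1 ∧
      ⁅b 2, b 1⁆ = (-(1 / 4) : ℂ) • b 0 + (1 : ℂ) • b 1 ∧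
      ⁅b 0, b 1⁆ = 0) ∧
      LieAlgebra.IsSolvable (subalg .L3_quarter_1) ∧
      ∀ X, X ∈ subalg .L3_quarter_1 ↔
        ∃ a b c : ℂ, X = a • x₁ + b • x₃ + c • ((2 : ℂ) • h₁ + h₂ + x₂) := by
  refine gen_spec (elt 0 0 1 0 0 0 0 0) (elt 0 0 (1 / 2) 0 (1 / 6) 0 0 0)
    (elt (1 / 3) (1 / 6) 0 (1 / 6) 0 0 0 0) 0 1 (-(1 / 4)) 1 ?_ ?_ ?_ ?_
    ⟨1, 0, 0, ?_⟩ ⟨1 / 2, 1 / 6, 0, ?_⟩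
    ⟨0, 0, 1 / 6, ?_⟩ ⟨1, 0, 0, ?_⟩
    ⟨-3, 6, 0, ?_⟩ ⟨0, 0, 6, ?_⟩
  · intro a b c
    simp only [elt_add, elt_smul, elt_inj]
    grind
  all_goals
    simp only [elt_add, elt_sub, elt_smul, elt_lie, elt_inj, x₁, x₂, x₃, y₁, y₂, y₃, h₁, h₂]
    norm_num

theorem spec_L3_quarter_2 :
    (∃ b : Module.Basis (Fin 3) ℂ (subalg .L3_quarter_2), ⁅b 2, b 0⁆ = (0 : ℂ) • b 0 + (1 : ℂ) • b 1 ∧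
      ⁅b 2, b 1⁆ = (-(1 / 4) : ℂ) • b 0 + (1 : ℂ) • b 1 ∧
      ⁅b 0, b 1⁆ = 0) ∧
      LieAlgebra.IsSolvable (subalg .L3_quarter_2) ∧
      ∀ X, X ∈ subalg .L3_quarter_2 ↔
        ∃ a b c : ℂ, X = a • y₁ + b • y₃ + c • ((2 : ℂ) • h₁ + h₂ + x₂) := by
  refine gen_spec (elt 0 0 0 0 0 0 0 1) (elt 0 0 0 0 0 (1 / 6) 0 (1 / 2))
    (elt (-(1 / 3)) (-(1 / 6)) 0 (-(1 / 6)) 0 0 0 0) 0 1 (-(1 / 4)) 1 ?_ ?_ ?_ ?_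
    ⟨0, 1, 0, ?_⟩ ⟨1 / 6, 1 / 2, 0, ?_⟩
    ⟨0, 0, -(1 / 6), ?_⟩ ⟨-3, 6, 0, ?_⟩
    ⟨1, 0, 0, ?_⟩ ⟨0, 0, -6, ?_⟩
  · intro a b c
    simp only [elt_add, elt_smul, elt_inj]
    grind
  all_goals
    simp only [elt_add, elt_sub, elt_smul, elt_lie, elt_inj, x₁, x₂, x₃, y₁, y₂, y₃, h₁, h₂]
    norm_num

theorem spec_L3_two_ninths :
    (∃ b : Module.Basis (Fin 3) ℂ (subalg .L3_two_ninths), ⁅b 2, b 0⁆ = (0 : ℂ) • b 0 + (1 : ℂ) • b 1 ∧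
      ⁅b 2, b 1⁆ = (-(2 / 9) : ℂ) • b 0 + (1 : ℂ) • b 1 ∧
      ⁅b 0, b 1⁆ = 0) ∧
      LieAlgebra.IsSolvable (subalg .L3_two_ninths) ∧
      ∀ X, X ∈ subalg .L3_two_ninths ↔
        ∃ a b c : ℂ, X = a • (x₁ + x₂) + b • x₃ + c • (h₁ + h₂) := by
  refine gen_spec (elt 0 0 1 1 1 0 0 0) (elt 0 0 (1 / 3) (1 / 3) (2 / 3) 0 0 0)
    (elt (1 / 3) (1 / 3) 0 0 0 0 0 0) 0 1 (-(2 / 9)) 1 ?_ ?_ ?_ ?_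
    ⟨1, 1, 0, ?_⟩ ⟨1 / 3, 2 / 3, 0, ?_⟩
    ⟨0, 0, 1 / 3, ?_⟩ ⟨2, -3, 0, ?_⟩
    ⟨-1, 3, 0, ?_⟩ ⟨0, 0, 3, ?_⟩
  · intro a b c
    simp only [elt_add, elt_smul, elt_inj]
    grind
  all_goals
    simp only [elt_add, elt_sub, elt_smul, elt_lie, elt_inj, x₁, x₂, x₃, y₁, y₂, y₃, h₁, h₂]
    norm_num

theorem spec_L3_zero :
    (∃ b : Module.Basis (Fin 3) ℂ (subalg .L3_zero), ⁅b 2, b 0⁆ = (0 : ℂ) • b 0 + (1 : ℂ) • b 1 ∧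
      ⁅b 2, b 1⁆ = (0 : ℂ) • b 0 + (1 : ℂ) • b 1 ∧
      ⁅b 0, b 1⁆ = 0) ∧
      LieAlgebra.IsSolvable (subalg .L3_zero) ∧
      ∀ X, X ∈ subalg .L3_zero ↔
        ∃ a b c : ℂ, X = a • x₁ + b • h₁ + c • h₂ := by
  -- The abelian ideal is spanned by `x₁` and `h₁ + 2 h₂`, which commutes with `x₁`; `h₁ / 2` acts
  -- on it with eigenvalues `1` and `0`.
  refine gen_spec (elt 1 2 1 0 0 0 0 0) (elt 0 0 1 0 0 0 0 0)
    (elt (1 / 2) 0 0 0 0 0 0 0) 0 1 0 1 ?_ ?_ ?_ ?_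
    ⟨1, 1, 2, ?_⟩ ⟨1, 0, 0, ?_⟩
    ⟨0, 1 / 2, 0, ?_⟩ ⟨0, 1, 0, ?_⟩
    ⟨0, 0, 2, ?_⟩ ⟨1 / 2, -(1 / 2), -1, ?_⟩
  · intro a b c
    simp only [elt_add, elt_smul, elt_inj]
    grind
  all_goals
    simp only [elt_add, elt_sub, elt_smul, elt_lie, elt_inj, x₁, x₂, x₃, y₁, y₂, y₃, h₁, h₂]
    norm_num

theorem spec_family₁ (α : ℂ) (hα₁ : α ≠ 1) (hα₂ : α ≠ -1) :
    (∃ b : Module.Basis (Fin 3) ℂ (subalg (.family₁ α hα₁ hα₂)), ⁅b 2, b 0⁆ = (0 : ℂ) • b 0 + (1 : ℂ) • b 1 ∧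
      ⁅b 2, b 1⁆ = (-((2 * α - 1) * (α - 2) / (9 * (α - 1) ^ 2)) : ℂ) • b 0 + (1 : ℂ) • b 1 ∧
      ⁅b 0, b 1⁆ = 0) ∧
      LieAlgebra.IsSolvable (subalg (.family₁ α hα₁ hα₂)) ∧
      ∀ X, X ∈ subalg (.family₁ α hα₁ hα₂) ↔
        ∃ a b c : ℂ, X = a • x₁ + b • x₃ + c • ((α - 1) • h₁ + α • h₂) := by
  have h1 : α - 1 ≠ 0 := sub_ne_zero.2 hα₁
  have h2 : α + 1 ≠ 0 := fun h => hα₂ (eq_neg_of_add_eq_zero_left h)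
  -- The generator acts on `x₁` and `x₃` by `α - 2` and `2α - 1`. Their sum is `3 (α - 1)`, whence
  -- the scaling and `α ≠ 1`; they differ because `α ≠ -1`, which makes `x₁ + x₃` cyclic.
  refine gen_spec (elt 0 0 1 0 1 0 0 0) (elt 0 0 ((α - 2) / (3 * (α - 1))) 0 ((2 * α - 1) / (3 * (α - 1))) 0 0 0)
    (elt (1 / 3) (α / (3 * (α - 1))) 0 0 0 0 0 0) 0 1 (-((2 * α - 1) * (α - 2) / (9 * (α - 1) ^ 2))) 1 ?_ ?_ ?_ ?_
    ⟨1, 1, 0, ?_⟩ ⟨(α - 2) / (3 * (α - 1)), (2 * α - 1) / (3 * (α - 1)), 0, ?_⟩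
    ⟨0, 0, 1 / (3 * (α - 1)), ?_⟩ ⟨(2 * α - 1) / (α + 1), -(3 * (α - 1)) / (α + 1), 0, ?_⟩
    ⟨-(α - 2) / (α + 1), 3 * (α - 1) / (α + 1), 0, ?_⟩ ⟨0, 0, 3 * (α - 1), ?_⟩
  · intro a b c
    simp only [elt_add, elt_smul, elt_inj]
    grind
  all_goals
    simp only [elt_add, elt_sub, elt_smul, elt_lie, elt_inj, x₁, x₂, x₃, y₁, y₂, y₃, h₁, h₂]
    grind

theorem spec_family₂ (α : ℂ) (hα₁ : α ≠ 1) (hα₂ : α ≠ -1) :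
    (∃ b : Module.Basis (Fin 3) ℂ (subalg (.family₂ α hα₁ hα₂)), ⁅b 2, b 0⁆ = (0 : ℂ) • b 0 + (1 : ℂ) • b 1 ∧
      ⁅b 2, b 1⁆ = (-((2 * α - 1) * (α - 2) / (9 * (α - 1) ^ 2)) : ℂ) • b 0 + (1 : ℂ) • b 1 ∧
      ⁅b 0, b 1⁆ = 0) ∧
      LieAlgebra.IsSolvable (subalg (.family₂ α hα₁ hα₂)) ∧
      ∀ X, X ∈ subalg (.family₂ α hα₁ hα₂) ↔
        ∃ a b c : ℂ, X = a • x₁ + b • y₂ + c • (h₁ + α • h₂) := by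
  have h1 : α - 1 ≠ 0 := sub_ne_zero.2 hα₁
  have h2 : α + 1 ≠ 0 := fun h => hα₂ (eq_neg_of_add_eq_zero_left h)
  refine gen_spec (elt 0 0 1 0 0 0 1 0) (elt 0 0 ((α - 2) / (3 * (α - 1))) 0 0 0 ((2 * α - 1) / (3 * (α - 1))) 0)
    (elt (-(1 / (3 * (α - 1)))) (-(α / (3 * (α - 1)))) 0 0 0 0 0 0) 0 1 (-((2 * α - 1) * (α - 2) / (9 * (α - 1) ^ 2))) 1 ?_ ?_ ?_ ?_
    ⟨1, 1, 0, ?_⟩ ⟨(α - 2) / (3 * (α - 1)), (2 * α - 1) / (3 * (α - 1)), 0, ?_⟩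
    ⟨0, 0, -(1 / (3 * (α - 1))), ?_⟩ ⟨(2 * α - 1) / (α + 1), -(3 * (α - 1)) / (α + 1), 0, ?_⟩
    ⟨-(α - 2) / (α + 1), 3 * (α - 1) / (α + 1), 0, ?_⟩ ⟨0, 0, -(3 * (α - 1)), ?_⟩
  · intro a b c
    simp only [elt_add, elt_smul, elt_inj]
    grind
  all_goals
    simp only [elt_add, elt_sub, elt_smul, elt_lie, elt_inj, x₁, x₂, x₃, y₁, y₂, y₃, h₁, h₂]
    grind

theorem spec_L4_1 :
    (∃ b : Module.Basis (Fin 3) ℂ (subalg .L4_1), ⁅b 2, b 0⁆ = (0 : ℂ) • b 0 + (1 : ℂ) • b 1 ∧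
      ⁅b 2, b 1⁆ = (1 : ℂ) • b 0 + (0 : ℂ) • b 1 ∧
      ⁅b 0, b 1⁆ = 0) ∧
      LieAlgebra.IsSolvable (subalg .L4_1) ∧
      ∀ X, X ∈ subalg .L4_1 ↔
        ∃ a b c : ℂ, X = a • x₁ + b • x₃ + c • h₂ := by
  refine gen_spec (elt 0 0 1 0 1 0 0 0) (elt 0 0 (-1) 0 1 0 0 0)
    (elt 0 1 0 0 0 0 0 0) 0 1 1 0 ?_ ?_ ?_ ?_
    ⟨1, 1, 0, ?_⟩ ⟨-1, 1, 0, ?_⟩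
    ⟨0, 0, 1, ?_⟩ ⟨1 / 2, -(1 / 2), 0, ?_⟩
    ⟨1 / 2, 1 / 2, 0, ?_⟩ ⟨0, 0, 1, ?_⟩
  · intro a b c
    simp only [elt_add, elt_smul, elt_inj]
    grind
  all_goals
    simp only [elt_add, elt_sub, elt_smul, elt_lie, elt_inj, x₁, x₂, x₃, y₁, y₂, y₃, h₁, h₂]
    norm_num

theorem spec_L4_2 :
    (∃ b : Module.Basis (Fin 3) ℂ (subalg .L4_2), ⁅b 2, b 0⁆ = (0 : ℂ) • b 0 + (1 : ℂ) • b 1 ∧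
      ⁅b 2, b 1⁆ = (1 : ℂ) • b 0 + (0 : ℂ) • b 1 ∧
      ⁅b 0, b 1⁆ = 0) ∧
      LieAlgebra.IsSolvable (subalg .L4_2) ∧
      ∀ X, X ∈ subalg .L4_2 ↔
        ∃ a b c : ℂ, X = a • x₁ + b • y₂ + c • (h₁ + h₂) := by
  refine gen_spec (elt 0 0 1 0 0 0 1 0) (elt 0 0 1 0 0 0 (-1) 0)
    (elt 1 1 0 0 0 0 0 0) 0 1 1 0 ?_ ?_ ?_ ?_
    ⟨1, 1, 0, ?_⟩ ⟨1, -1, 0, ?_⟩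
    ⟨0, 0, 1, ?_⟩ ⟨1 / 2, 1 / 2, 0, ?_⟩
    ⟨1 / 2, -(1 / 2), 0, ?_⟩ ⟨0, 0, 1, ?_⟩
  · intro a b c
    simp only [elt_add, elt_smul, elt_inj]
    grind
  all_goals
    simp only [elt_add, elt_sub, elt_smul, elt_lie, elt_inj, x₁, x₂, x₃, y₁, y₂, y₃, h₁, h₂]
    norm_num

theorem spec_L5_1 :
    (∃ b : Module.Basis (Fin 3) ℂ (subalg .L5_1), ⁅b 2, b 0⁆ = (0 : ℂ) • b 0 + (1 : ℂ) • b 1 ∧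
      ⁅b 2, b 1⁆ = (0 : ℂ) • b 0 + (0 : ℂ) • b 1 ∧
      ⁅b 0, b 1⁆ = 0) ∧
      LieAlgebra.IsSolvable (subalg .L5_1) ∧
      ∀ X, X ∈ subalg .L5_1 ↔
        ∃ a b c : ℂ, X = a • x₁ + b • x₂ + c • x₃ := by
  refine gen_spec (elt 0 0 0 1 0 0 0 0) (elt 0 0 0 0 (-1) 0 0 0)
    (elt 0 0 1 0 0 0 0 0) 0 1 0 0 ?_ ?_ ?_ ?_
    ⟨0, 1, 0, ?_⟩ ⟨0, 0, -1, ?_⟩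
    ⟨1, 0, 0, ?_⟩ ⟨0, 0, 1, ?_⟩
    ⟨1, 0, 0, ?_⟩ ⟨0, -1, 0, ?_⟩
  · intro a b c
    simp only [elt_add, elt_smul, elt_inj]
    grind
  all_goals
    simp only [elt_add, elt_sub, elt_smul, elt_lie, elt_inj, x₁, x₂, x₃, y₁, y₂, y₃, h₁, h₂]
    norm_num

theorem listed_properties (l : Label) :
    Module.finrank ℂ (subalg l) = 3 ∧ LieAlgebra.IsSolvable (subalg l) ∧
      HasListedType (subalg l) l := by
  have key : ∀ {K : LieSubalgebra ℂ Alg}, Module.Basis (Fin 3) ℂ K → Module.finrank ℂ K = 3 :=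
    fun b => by rw [Module.finrank_eq_card_basis b, Fintype.card_fin]
  cases l with
  | L2_1 =>
    obtain ⟨⟨b, h⟩, hs, -⟩ := spec_L2_1
    exact ⟨key b, hs, b, by simpa using h⟩
  | L2_2 =>
    obtain ⟨⟨b, h⟩, hs, -⟩ := spec_L2_2
    exact ⟨key b, hs, b, by simpa using h⟩
  | L3_quarter_1 =>
    obtain ⟨⟨b, h⟩, hs, -⟩ := spec_L3_quarter_1
    exact ⟨key b, hs, b, by simpa only [zero_smul, one_smul, zero_add] using h⟩
  | L3_quarter_2 =>
    obtain ⟨⟨b, h⟩, hs, -⟩ := spec_L3_quarter_2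
    exact ⟨key b, hs, b, by simpa only [zero_smul, one_smul, zero_add] using h⟩
  | L3_two_ninths =>
    obtain ⟨⟨b, h⟩, hs, -⟩ := spec_L3_two_ninths
    exact ⟨key b, hs, b, by simpa only [zero_smul, one_smul, zero_add] using h⟩
  | L3_zero =>
    obtain ⟨⟨b, h⟩, hs, -⟩ := spec_L3_zero
    exact ⟨key b, hs, b, by simpa only [zero_smul, one_smul, zero_add] using h⟩
  | family₁ α h1 h2 =>
    obtain ⟨⟨b, h⟩, hs, -⟩ := spec_family₁ α h1 h2
    exact ⟨key b, hs, b, by simpa only [zero_smul, one_smul, zero_add] using h⟩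
  | family₂ α h1 h2 =>
    obtain ⟨⟨b, h⟩, hs, -⟩ := spec_family₂ α h1 h2
    exact ⟨key b, hs, b, by simpa only [zero_smul, one_smul, zero_add] using h⟩
  | L4_1 =>
    obtain ⟨⟨b, h⟩, hs, -⟩ := spec_L4_1
    exact ⟨key b, hs, b, by simpa using h⟩
  | L4_2 =>
    obtain ⟨⟨b, h⟩, hs, -⟩ := spec_L4_2
    exact ⟨key b, hs, b, by simpa using h⟩
  | L5_1 =>
    obtain ⟨⟨b, h⟩, hs, -⟩ := spec_L5_1
    exact ⟨key b, hs, b, by simpa using h⟩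

/-! ### The members of the listed subalgebras in coordinates -/

theorem mem_L2_1 {X : Alg} :
    X ∈ subalg .L2_1 ↔ ∃ a b c : ℂ, X = elt (2 * c) c a 0 b 0 0 0 := by
  simp [spec_L2_1.2.2, elt_add, elt_smul, x₁, x₃, h₁, h₂, mul_comm]

theorem mem_L2_2 {X : Alg} :
    X ∈ subalg .L2_2 ↔ ∃ a b c : ℂ, X = elt c (-c) a 0 0 0 b 0 := by
  simp [spec_L2_2.2.2, elt_add, elt_sub, elt_smul, x₁, y₂, h₁, h₂]

theorem mem_L3_quarter_1 {X : Alg} :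
    X ∈ subalg .L3_quarter_1 ↔ ∃ a b c : ℂ, X = elt (2 * c) c a c b 0 0 0 := by
  simp [spec_L3_quarter_1.2.2, elt_add, elt_smul, x₁, x₂, x₃, h₁, h₂, mul_comm]

theorem mem_L3_quarter_2 {X : Alg} :
    X ∈ subalg .L3_quarter_2 ↔ ∃ a b c : ℂ, X = elt (2 * c) c 0 c 0 a 0 b := by
  simp [spec_L3_quarter_2.2.2, elt_add, elt_smul, x₂, y₁, y₃, h₁, h₂, mul_comm]

theorem mem_L3_two_ninths {X : Alg} :
    X ∈ subalg .L3_two_ninths ↔ ∃ a b c : ℂ, X = elt c c a a b 0 0 0 := by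
  simp [spec_L3_two_ninths.2.2, elt_add, elt_smul, x₁, x₂, x₃, h₁, h₂]

theorem mem_L3_zero {X : Alg} :
    X ∈ subalg .L3_zero ↔ ∃ a b c : ℂ, X = elt b c a 0 0 0 0 0 := by
  simp [spec_L3_zero.2.2, elt_add, elt_smul, x₁, h₁, h₂]

theorem mem_family₁ {α : ℂ} {hα₁ : α ≠ 1} {hα₂ : α ≠ -1} {X : Alg} :
    X ∈ subalg (.family₁ α hα₁ hα₂) ↔
      ∃ a b c : ℂ, X = elt (c * (α - 1)) (c * α) a 0 b 0 0 0 := by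
  simp [(spec_family₁ α hα₁ hα₂).2.2, elt_add, elt_smul, x₁, x₃, h₁, h₂]

theorem mem_family₂ {α : ℂ} {hα₁ : α ≠ 1} {hα₂ : α ≠ -1} {X : Alg} :
    X ∈ subalg (.family₂ α hα₁ hα₂) ↔ ∃ a b c : ℂ, X = elt c (c * α) a 0 0 0 b 0 := by
  simp [(spec_family₂ α hα₁ hα₂).2.2, elt_add, elt_smul, x₁, y₂, h₁, h₂]

theorem mem_L4_1 {X : Alg} :
    X ∈ subalg .L4_1 ↔ ∃ a b c : ℂ, X = elt 0 c a 0 b 0 0 0 := by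
  simp [spec_L4_1.2.2, elt_add, elt_smul, x₁, x₃, h₂]

theorem mem_L4_2 {X : Alg} :
    X ∈ subalg .L4_2 ↔ ∃ a b c : ℂ, X = elt c c a 0 0 0 b 0 := by
  simp [spec_L4_2.2.2, elt_add, elt_smul, x₁, y₂, h₁, h₂]

theorem mem_L5_1 {X : Alg} :
    X ∈ subalg .L5_1 ↔ ∃ a b c : ℂ, X = elt 0 0 a b c 0 0 0 := by
  simp [spec_L5_1.2.2, elt_add, elt_smul, x₁, x₂, x₃]

/-! ### Conjugation invariants -/

/-- All elements of `K` have vanishing cube. -/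
def AllNil (K : LieSubalgebra ℂ Alg) : Prop := ∀ X ∈ K, (X : M3) ^ 3 = 0

/-- `K` contains a nilpotent element whose square does not vanish. -/
def HasRegularNil (K : LieSubalgebra ℂ Alg) : Prop :=
  ∃ X ∈ K, (X : M3) ^ 3 = 0 ∧ (X : M3) ^ 2 ≠ 0

/-- Each element of `K` satisfies a quadratic equation with roots `-c`, `2c`. -/
def AllQuadratic (K : LieSubalgebra ℂ Alg) : Prop :=
  ∀ X ∈ K, ∃ c : ℂ, (X : M3) ^ 2 = c • (X : M3) + (2 * c ^ 2) • (1 : M3)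

/-- The nilpotent elements of `K` have their image in a common line, and the eigenvalue `c` of
`Y ∈ K` on this line satisfies `(α - 1)² tr Y² = 2 (α² - α + 1) c²`. -/
def ImageInv (α : ℂ) (K : LieSubalgebra ℂ Alg) : Prop :=
  ∃ Q : M3, Q * Q = Q ∧ Q.trace = 1 ∧ (∀ X ∈ K, (X : M3) ^ 3 = 0 → Q * X = X) ∧
    ∀ Y ∈ K, ∃ c : ℂ, (Y : M3) * Q = c • Q ∧
      (α - 1) ^ 2 * ((Y : M3) * Y).trace = 2 * (α ^ 2 - α + 1) * c ^ 2

/-- The nilpotent elements of `K` vanish on a common plane, and the eigenvalue `c` of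
`Y ∈ K` on the quotient by this plane satisfies `(α - 1)² tr Y² = 2 (α² - α + 1) c²`. -/
def KernelInv (α : ℂ) (K : LieSubalgebra ℂ Alg) : Prop :=
  ∃ Q : M3, Q * Q = Q ∧ Q.trace = 1 ∧ (∀ X ∈ K, (X : M3) ^ 3 = 0 → X * Q = X) ∧
    ∀ Y ∈ K, ∃ c : ℂ, Q * (Y : M3) = c • Q ∧
      (α - 1) ^ 2 * ((Y : M3) * Y).trace = 2 * (α ^ 2 - α + 1) * c ^ 2

theorem mem_map_conj {K : LieSubalgebra ℂ Alg} {P : M3ˣ} {Y : Alg} :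
    Y ∈ K.map (conj P : Alg →ₗ⁅ℂ⁆ Alg) ↔ ∃ X ∈ K, (Y : M3) = P * X * (P⁻¹ : M3ˣ) := by
  constructor
  · rintro ⟨X, hX, rfl⟩
    exact ⟨X, hX, rfl⟩
  · rintro ⟨X, hX, h⟩
    exact ⟨X, hX, Subtype.ext h.symm⟩

theorem conj_pow (P : M3ˣ) (X : M3) (n : ℕ) :
    (P * X * (P⁻¹ : M3ˣ) : M3) ^ n = P * X ^ n * (P⁻¹ : M3ˣ) := Units.conj_pow P X n

theorem conj_eq_zero_iff (P : M3ˣ) (X : M3) : (P * X * (P⁻¹ : M3ˣ) : M3) = 0 ↔ X = 0 := by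
  rw [Units.mul_left_eq_zero, Units.mul_right_eq_zero]

theorem trace_conj (P : M3ˣ) (X : M3) : (P * X * (P⁻¹ : M3ˣ) : M3).trace = X.trace := by
  rw [Matrix.trace_mul_comm, ← mul_assoc, Units.inv_mul, one_mul]

theorem conj_mul_conj (P : M3ˣ) (X Y : M3) :
    (P * X * (P⁻¹ : M3ˣ) : M3) * (P * Y * (P⁻¹ : M3ˣ)) = P * (X * Y) * (P⁻¹ : M3ˣ) := by
  simp [mul_assoc]

theorem conj_smul (P : M3ˣ) (c : ℂ) (X : M3) :
    (P * (c • X) * (P⁻¹ : M3ˣ) : M3) = c • (P * X * (P⁻¹ : M3ˣ) : M3) := by simp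

theorem AllNil.of_equiv {K K' : LieSubalgebra ℂ Alg} (h : InnerEquivalent K K') (hK : AllNil K) :
    AllNil K' := by
  obtain ⟨P, rfl⟩ := innerEquivalent_iff.1 h
  intro Y hY
  obtain ⟨X, hX, hXY⟩ := mem_map_conj.1 hY
  rw [hXY, conj_pow, hK X hX, mul_zero, zero_mul]

theorem HasRegularNil.of_equiv {K K' : LieSubalgebra ℂ Alg} (h : InnerEquivalent K K')
    (hK : HasRegularNil K) : HasRegularNil K' := by
  obtain ⟨P, rfl⟩ := innerEquivalent_iff.1 h
  obtain ⟨X, hX, h3, h2⟩ := hK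
  refine ⟨conj P X, ⟨X, hX, rfl⟩, ?_, ?_⟩
  · rw [coe_conj, conj_pow, h3, mul_zero, zero_mul]
  · rwa [coe_conj, conj_pow, Ne, conj_eq_zero_iff]

theorem AllQuadratic.of_equiv {K K' : LieSubalgebra ℂ Alg} (h : InnerEquivalent K K')
    (hK : AllQuadratic K) : AllQuadratic K' := by
  obtain ⟨P, rfl⟩ := innerEquivalent_iff.1 h
  intro Y hY
  obtain ⟨X, hX, hXY⟩ := mem_map_conj.1 hY
  obtain ⟨c, hc⟩ := hK X hX
  refine ⟨c, ?_⟩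
  rw [hXY, conj_pow, hc]
  simp [mul_add, add_mul]

theorem ImageInv.of_equiv {α : ℂ} {K K' : LieSubalgebra ℂ Alg} (h : InnerEquivalent K K')
    (hK : ImageInv α K) : ImageInv α K' := by
  obtain ⟨P, rfl⟩ := innerEquivalent_iff.1 h
  obtain ⟨Q, hQ, htr, hnil, hall⟩ := hK
  refine ⟨P * Q * (P⁻¹ : M3ˣ), by rw [conj_mul_conj, hQ], by rw [trace_conj, htr],
    fun Y hY h3 => ?_, fun Z hZ => ?_⟩
  · obtain ⟨X, hX, hXY⟩ := mem_map_conj.1 hY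
    rw [hXY] at h3 ⊢
    rw [conj_pow, conj_eq_zero_iff] at h3
    rw [conj_mul_conj, hnil X hX h3]
  · obtain ⟨Y, hY, hYZ⟩ := mem_map_conj.1 hZ
    obtain ⟨c, h1, h2⟩ := hall Y hY
    rw [hYZ]
    exact ⟨c, by rw [conj_mul_conj, h1, conj_smul], by rw [conj_mul_conj, trace_conj, h2]⟩

theorem KernelInv.of_equiv {α : ℂ} {K K' : LieSubalgebra ℂ Alg} (h : InnerEquivalent K K')
    (hK : KernelInv α K) : KernelInv α K' := by
  obtain ⟨P, rfl⟩ := innerEquivalent_iff.1 h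
  obtain ⟨Q, hQ, htr, hnil, hall⟩ := hK
  refine ⟨P * Q * (P⁻¹ : M3ˣ), by rw [conj_mul_conj, hQ], by rw [trace_conj, htr],
    fun Y hY h3 => ?_, fun Z hZ => ?_⟩
  · obtain ⟨X, hX, hXY⟩ := mem_map_conj.1 hY
    rw [hXY] at h3 ⊢
    rw [conj_pow, conj_eq_zero_iff] at h3
    rw [conj_mul_conj, hnil X hX h3]
  · obtain ⟨Y, hY, hYZ⟩ := mem_map_conj.1 hZ
    obtain ⟨c, h1, h2⟩ := hall Y hY
    rw [hYZ]
    exact ⟨c, by rw [conj_mul_conj, h1, conj_smul], by rw [conj_mul_conj, trace_conj, h2]⟩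

/-! ### Symmetry and transitivity of equivalence. -/

theorem innerEquivalent_symm {K K' : LieSubalgebra ℂ Alg} (h : InnerEquivalent K K') :
    InnerEquivalent K' K := by
  obtain ⟨P, rfl⟩ := innerEquivalent_iff.1 h
  refine innerEquivalent_iff.2 ⟨P⁻¹, ?_⟩
  ext X
  constructor
  · rintro ⟨_, ⟨Y, hY, rfl⟩, rfl⟩
    have : conj P⁻¹ (conj P Y) = Y := by rw [conj_inv, LieEquiv.symm_apply_apply]
    exact (congrArg (· ∈ K) this).mpr hY
  · intro hX
    refine ⟨conj P X, ⟨X, hX, rfl⟩, ?_⟩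
    change conj P⁻¹ (conj P X) = X
    rw [conj_inv, LieEquiv.symm_apply_apply]

theorem innerEquivalent_trans {K K' K'' : LieSubalgebra ℂ Alg} (h : InnerEquivalent K K')
    (h' : InnerEquivalent K' K'') : InnerEquivalent K K'' := by
  obtain ⟨P, rfl⟩ := innerEquivalent_iff.1 h
  obtain ⟨Q, rfl⟩ := innerEquivalent_iff.1 h'
  refine innerEquivalent_iff.2 ⟨Q * P, ?_⟩
  rw [conj_mul]
  ext X
  constructor
  · rintro ⟨Y, hY, rfl⟩
    exact ⟨_, ⟨Y, hY, rfl⟩, rfl⟩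
  · rintro ⟨_, ⟨Y, hY, rfl⟩, rfl⟩
    exact ⟨Y, hY, rfl⟩

/-! ### Values of the invariants -/

theorem trace_sq_elt (a b c d e f g h : ℂ) :
    ((elt a b c d e f g h : M3) * (elt a b c d e f g h : M3)).trace =
      a ^ 2 + (b - a) ^ 2 + b ^ 2 + 2 * (c * f + d * g + e * h) := by
  rw [Matrix.trace_fin_three, coe_elt]
  simp
  ring

theorem cube_upper {a b c d e : ℂ} (h : (elt a b c d e 0 0 0 : M3) ^ 3 = 0) : a = 0 ∧ b = 0 := by
  rw [coe_elt, pow_three] at h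
  have h0 := congrFun (congrFun h 0) 0
  have h2 := congrFun (congrFun h 2) 2
  simp at h0 h2
  exact ⟨h0, h2⟩

theorem cube_column {a b c g : ℂ} (h : (elt a b c 0 0 0 g 0 : M3) ^ 3 = 0) : a = 0 ∧ b = 0 := by
  rw [coe_elt, pow_three] at h
  have h0 := congrFun (congrFun h 0) 0
  have h2 := congrFun (congrFun h 2) 2
  simp at h0 h2
  exact ⟨h0, h2⟩

theorem cube_strictly_upper (c d e : ℂ) : (elt 0 0 c d e 0 0 0 : M3) ^ 3 = 0 := by
  rw [coe_elt, pow_three]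
  ext i j
  fin_cases i <;> fin_cases j <;> simp

theorem cube_strictly_lower (f g h : ℂ) : (elt 0 0 0 0 0 f g h : M3) ^ 3 = 0 := by
  rw [coe_elt, pow_three]
  ext i j
  fin_cases i <;> fin_cases j <;> simp

theorem cube_strict_column (c g : ℂ) : (elt 0 0 c 0 0 0 g 0 : M3) ^ 3 = 0 := by
  rw [coe_elt, pow_three]
  ext i j
  fin_cases i <;> fin_cases j <;> simp

theorem imageInv_of_upper {α : ℂ} {K : LieSubalgebra ℂ Alg}
    (hK : ∀ X ∈ K, ∃ a b c d e : ℂ, X = elt a b c d e 0 0 0 ∧ (a = 0 → b = 0 → d = 0) ∧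
      (α - 1) ^ 2 * (a ^ 2 + (b - a) ^ 2 + b ^ 2) = 2 * (α ^ 2 - α + 1) * a ^ 2) :
    ImageInv α K := by
  refine ⟨!![1, 0, 0; 0, 0, 0; 0, 0, 0], ?_, ?_, fun X hX h3 => ?_, fun Y hY => ?_⟩
  · ext i j
    fin_cases i <;> fin_cases j <;> simp
  · simp [Matrix.trace_fin_three]
  · obtain ⟨a, b, c, d, e, rfl, hd, -⟩ := hK X hX
    obtain ⟨rfl, rfl⟩ := cube_upper h3
    obtain rfl := hd rfl rfl
    rw [coe_elt]
    ext i j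
    fin_cases i <;> fin_cases j <;> simp
  · obtain ⟨a, b, c, d, e, rfl, -, h⟩ := hK Y hY
    refine ⟨a, ?_, ?_⟩
    · rw [coe_elt]
      ext i j
      fin_cases i <;> fin_cases j <;> simp
    · rw [trace_sq_elt, ← h]
      ring

theorem kernelInv_of_column {α : ℂ} {K : LieSubalgebra ℂ Alg}
    (hK : ∀ X ∈ K, ∃ a b c g : ℂ, X = elt a b c 0 0 0 g 0 ∧
      (α - 1) ^ 2 * (a ^ 2 + (b - a) ^ 2 + b ^ 2) = 2 * (α ^ 2 - α + 1) * (b - a) ^ 2) :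
    KernelInv α K := by
  refine ⟨!![0, 0, 0; 0, 1, 0; 0, 0, 0], ?_, ?_, fun X hX h3 => ?_, fun Y hY => ?_⟩
  · ext i j
    fin_cases i <;> fin_cases j <;> simp
  · simp [Matrix.trace_fin_three]
  · obtain ⟨a, b, c, g, rfl, -⟩ := hK X hX
    obtain ⟨rfl, rfl⟩ := cube_column h3
    rw [coe_elt]
    ext i j
    fin_cases i <;> fin_cases j <;> simp
  · obtain ⟨a, b, c, g, rfl, h⟩ := hK Y hY
    refine ⟨b - a, ?_, ?_⟩
    · rw [coe_elt]
      ext i j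
      fin_cases i <;> fin_cases j <;> simp
    · rw [trace_sq_elt, ← h]
      ring

/-- Here the common kernel is the plane of `e₂` and `e₃`, so the complementary projection is onto
the first coordinate and `kernelInv_of_column` does not apply. -/
theorem kernelInv_L3_quarter_2 : KernelInv (-1) (subalg .L3_quarter_2) := by
  refine ⟨!![1, 0, 0; 0, 0, 0; 0, 0, 0], ?_, ?_, fun X hX h3 => ?_, fun Y hY => ?_⟩
  · ext i j
    fin_cases i <;> fin_cases j <;> simp
  · simp [Matrix.trace_fin_three]
  · obtain ⟨a, b, c, rfl⟩ := mem_L3_quarter_2.1 hX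
    have h0 := congrFun (congrFun h3 0) 0
    rw [coe_elt, pow_three] at h0
    simp at h0
    subst h0
    rw [coe_elt]
    ext i j
    fin_cases i <;> fin_cases j <;> simp
  · obtain ⟨a, b, c, rfl⟩ := mem_L3_quarter_2.1 hY
    refine ⟨2 * c, ?_, ?_⟩
    · rw [coe_elt]
      ext i j
      fin_cases i <;> fin_cases j <;> simp
    · rw [trace_sq_elt]
      ring

/-- The parameter of the labels whose nilpotent elements have their image in a common line. -/
def imageParam : Label → Option ℂ
  | .L2_1 => some (-1)
  | .L3_quarter_1 => some (-1)
  | .family₁ α _ _ => some α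
  | .L4_1 => some 1
  | _ => none

/-- The parameter of the labels whose nilpotent elements vanish on a common plane. -/
def kernelParam : Label → Option ℂ
  | .L2_2 => some (-1)
  | .L3_quarter_2 => some (-1)
  | .family₂ α _ _ => some α
  | .L4_2 => some 1
  | _ => none

theorem imageInv_of_param {l : Label} {α : ℂ} (h : imageParam l = some α) :
    ImageInv α (subalg l) := by
  cases l with
  | L2_1 =>
    obtain rfl : -1 = α := by simpa [imageParam] using h
    refine imageInv_of_upper fun X hX => ?_
    obtain ⟨a, b, c, rfl⟩ := mem_L2_1.1 hX
    exact ⟨_, _, _, _, _, rfl, fun _ _ => rfl, by ring⟩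
  | L3_quarter_1 =>
    obtain rfl : -1 = α := by simpa [imageParam] using h
    refine imageInv_of_upper fun X hX => ?_
    obtain ⟨a, b, c, rfl⟩ := mem_L3_quarter_1.1 hX
    exact ⟨_, _, _, _, _, rfl, fun _ h => h, by ring⟩
  | family₁ β h1 h2 =>
    obtain rfl : β = α := by simpa [imageParam] using h
    refine imageInv_of_upper fun X hX => ?_
    obtain ⟨a, b, c, rfl⟩ := mem_family₁.1 hX
    exact ⟨_, _, _, _, _, rfl, fun _ _ => rfl, by ring⟩
  | L4_1 =>
    obtain rfl : 1 = α := by simpa [imageParam] using h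
    refine imageInv_of_upper fun X hX => ?_
    obtain ⟨a, b, c, rfl⟩ := mem_L4_1.1 hX
    exact ⟨_, _, _, _, _, rfl, fun _ _ => rfl, by ring⟩
  | _ => simp [imageParam] at h

theorem kernelInv_of_param {l : Label} {α : ℂ} (h : kernelParam l = some α) :
    KernelInv α (subalg l) := by
  cases l with
  | L2_2 =>
    obtain rfl : -1 = α := by simpa [kernelParam] using h
    refine kernelInv_of_column fun X hX => ?_
    obtain ⟨a, b, c, rfl⟩ := mem_L2_2.1 hX
    exact ⟨_, _, _, _, rfl, by ring⟩
  | L3_quarter_2 =>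
    obtain rfl : -1 = α := by simpa [kernelParam] using h
    exact kernelInv_L3_quarter_2
  | family₂ β h1 h2 =>
    obtain rfl : β = α := by simpa [kernelParam] using h
    refine kernelInv_of_column fun X hX => ?_
    obtain ⟨a, b, c, rfl⟩ := mem_family₂.1 hX
    exact ⟨_, _, _, _, rfl, by ring⟩
  | L4_2 =>
    obtain rfl : 1 = α := by simpa [kernelParam] using h
    refine kernelInv_of_column fun X hX => ?_
    obtain ⟨a, b, c, rfl⟩ := mem_L4_2.1 hX
    exact ⟨_, _, _, _, rfl, by ring⟩
  | _ => simp [kernelParam] at h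

/-! ### Consequences of the invariants for explicit members. -/

/-- Since `E₁₂` has image `ℂ e₁`, the projection `Q` fixes `e₁`, and the scalar by which `Y` acts
must be its upper left entry. -/
theorem ImageInv.eq_of_mem {α : ℂ} {K : LieSubalgebra ℂ Alg} (h : ImageInv α K)
    (hx : elt 0 0 1 0 0 0 0 0 ∈ K) {a b c d e : ℂ} (hY : elt a b c d e 0 0 0 ∈ K) :
    (α - 1) ^ 2 * (a ^ 2 + (b - a) ^ 2 + b ^ 2) = 2 * (α ^ 2 - α + 1) * a ^ 2 := by
  obtain ⟨Q, -, -, hnil, hall⟩ := h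
  have hQ := hnil _ hx (cube_strictly_upper _ _ _)
  obtain ⟨t, h1, h2⟩ := hall _ hY
  rw [coe_elt] at h1 hQ
  have q0 := congrFun (congrFun hQ 0) 1
  have q1 := congrFun (congrFun hQ 1) 1
  have q2 := congrFun (congrFun hQ 2) 1
  have e0 := congrFun (congrFun h1 0) 0
  simp [Matrix.mul_apply, Fin.sum_univ_three] at q0 q1 q2 e0
  rw [trace_sq_elt] at h2
  have hta : t = a := by rw [q0, q1, q2] at e0; simpa using e0.symm
  rw [← hta] at h2 ⊢
  rw [← h2]
  ring

theorem KernelInv.eq_of_mem {α : ℂ} {K : LieSubalgebra ℂ Alg} (h : KernelInv α K)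
    (hx : elt 0 0 1 0 0 0 0 0 ∈ K) {a b c g : ℂ} (hY : elt a b c 0 0 0 g 0 ∈ K) :
    (α - 1) ^ 2 * (a ^ 2 + (b - a) ^ 2 + b ^ 2) = 2 * (α ^ 2 - α + 1) * (b - a) ^ 2 := by
  obtain ⟨Q, -, -, hnil, hall⟩ := h
  have hQ := hnil _ hx (cube_strictly_upper _ _ _)
  obtain ⟨t, h1, h2⟩ := hall _ hY
  rw [coe_elt] at h1 hQ
  have q0 := congrFun (congrFun hQ 0) 0
  have q1 := congrFun (congrFun hQ 0) 1
  have q2 := congrFun (congrFun hQ 0) 2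
  have e0 := congrFun (congrFun h1 1) 1
  simp [Matrix.mul_apply, Fin.sum_univ_three] at q0 q1 q2 e0
  rw [trace_sq_elt] at h2
  have hta : t = b - a := by rw [q0, q1, q2] at e0; simpa using e0.symm
  rw [← hta] at h2 ⊢
  rw [← h2]
  ring

theorem KernelInv.eq_of_mem_lower {α : ℂ} {K : LieSubalgebra ℂ Alg} (h : KernelInv α K)
    (hx : elt 0 0 0 0 0 1 0 0 ∈ K) {a b d f g i : ℂ} (hY : elt a b 0 d 0 f g i ∈ K) :
    (α - 1) ^ 2 * (a ^ 2 + (b - a) ^ 2 + b ^ 2 + 2 * (d * g)) =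
      2 * (α ^ 2 - α + 1) * a ^ 2 := by
  obtain ⟨Q, -, -, hnil, hall⟩ := h
  have hQ := hnil _ hx (cube_strictly_lower _ _ _)
  obtain ⟨t, h1, h2⟩ := hall _ hY
  rw [coe_elt] at h1 hQ
  have q0 := congrFun (congrFun hQ 1) 0
  have q1 := congrFun (congrFun hQ 1) 1
  have q2 := congrFun (congrFun hQ 1) 2
  have e0 := congrFun (congrFun h1 0) 0
  simp [Matrix.mul_apply, Fin.sum_univ_three] at q0 q1 q2 e0
  rw [trace_sq_elt] at h2
  have hta : t = a := by rw [q0, q1, q2] at e0; simpa using e0.symm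
  rw [← hta] at h2 ⊢
  rw [← h2]
  ring

/-- A projection fixing two distinct basis vectors has rank at least two, contrary to its trace
being one. -/
theorem ImageInv.false_of_mem {α : ℂ} {K : LieSubalgebra ℂ Alg} (h : ImageInv α K) {X Y : Alg}
    (hX : X ∈ K) (hY : Y ∈ K) (hX3 : (X : M3) ^ 3 = 0) (hY3 : (Y : M3) ^ 3 = 0) {u v : Fin 3 → ℂ}
    {i j : Fin 3} (hij : i ≠ j) (hu : (X : M3) *ᵥ u = Pi.single i 1)
    (hv : (Y : M3) *ᵥ v = Pi.single j 1) : False := by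
  obtain ⟨Q, hQ, htr, hnil, -⟩ := h
  have h1 : Q *ᵥ Pi.single i 1 = Pi.single i 1 := by
    rw [← hu, Matrix.mulVec_mulVec, hnil X hX hX3]
  have h2 : Q *ᵥ Pi.single j 1 = Pi.single j 1 := by
    rw [← hv, Matrix.mulVec_mulVec, hnil Y hY hY3]
  rw [Matrix.mulVec_single_one] at h1 h2
  have e1 := fun k => congrFun h1 k
  have e2 := fun k => congrFun h2 k
  have e3 := fun k => congrFun (congrFun hQ k) k
  simp only [Matrix.col_apply, Matrix.mul_apply, Fin.sum_univ_three, Pi.single_apply] at e1 e2 e3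
  simp only [Matrix.trace_fin_three] at htr
  have e10 := e1 0
  have e11 := e1 1
  have e12 := e1 2
  have e20 := e2 0
  have e21 := e2 1
  have e22 := e2 2
  have e30 := e3 0
  have e31 := e3 1
  have e32 := e3 2
  clear e1 e2 e3
  fin_cases i <;> fin_cases j <;> simp at hij e10 e11 e12 e20 e21 e22 <;>
    simp [e10, e11, e12, e20, e21, e22] at htr e30 e31 e32 <;> grind

theorem KernelInv.false_of_mem {α : ℂ} {K : LieSubalgebra ℂ Alg} (h : KernelInv α K) {X Y : Alg}
    (hX : X ∈ K) (hY : Y ∈ K) (hX3 : (X : M3) ^ 3 = 0) (hY3 : (Y : M3) ^ 3 = 0) {u v : Fin 3 → ℂ}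
    {i j : Fin 3} (hij : i ≠ j) (hu : u ᵥ* (X : M3) = Pi.single i 1)
    (hv : v ᵥ* (Y : M3) = Pi.single j 1) : False := by
  obtain ⟨Q, hQ, htr, hnil, -⟩ := h
  have h1 : Pi.single i 1 ᵥ* Q = Pi.single i 1 := by
    rw [← hu, Matrix.vecMul_vecMul, hnil X hX hX3]
  have h2 : Pi.single j 1 ᵥ* Q = Pi.single j 1 := by
    rw [← hv, Matrix.vecMul_vecMul, hnil Y hY hY3]
  rw [Matrix.single_one_vecMul] at h1 h2
  have e1 := fun k => congrFun h1 k
  have e2 := fun k => congrFun h2 k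
  have e3 := fun k => congrFun (congrFun hQ k) k
  simp only [Matrix.row_apply, Matrix.mul_apply, Fin.sum_univ_three, Pi.single_apply] at e1 e2 e3
  simp only [Matrix.trace_fin_three] at htr
  have e10 := e1 0
  have e11 := e1 1
  have e12 := e1 2
  have e20 := e2 0
  have e21 := e2 1
  have e22 := e2 2
  have e30 := e3 0
  have e31 := e3 1
  have e32 := e3 2
  clear e1 e2 e3
  fin_cases i <;> fin_cases j <;> simp at hij e10 e11 e12 e20 e21 e22 <;>
    simp [e10, e11, e12, e20, e21, e22] at htr e30 e31 e32 <;> grind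

/-- Since `(α² - α + 1) / (α - 1)² = 1 + α / (α - 1)²`, the equation compares `α / (α - 1)²` with `β
/ (β - 1)²`; the cross-multiplied form also covers the value `1`. -/
theorem param_relation {α β : ℂ}
    (h : (α - 1) ^ 2 * (β ^ 2 - β + 1) = (α ^ 2 - α + 1) * (β - 1) ^ 2) : α = β ∨ α * β = 1 := by
  have : (α - β) * (α * β - 1) = 0 := by linear_combination h
  rcases mul_eq_zero.1 this with h | h
  · exact .inl (sub_eq_zero.1 h)
  · exact .inr (sub_eq_zero.1 h)

theorem ImageInv.param {l : Label} {α : ℂ} (h : ImageInv α (subalg l)) :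
    ∃ β, imageParam l = some β ∧ (α = β ∨ α * β = 1) := by
  cases l with
  | L2_1 =>
    refine ⟨-1, rfl, param_relation ?_⟩
    have := h.eq_of_mem (mem_L2_1.2 ⟨1, 0, 0, by simp⟩) (mem_L2_1.2 ⟨0, 0, 1, rfl⟩)
    linear_combination (1 / 2) * this
  | L2_2 =>
    refine (h.false_of_mem (mem_L2_2.2 ⟨1, 0, 0, by simp; rfl⟩) (mem_L2_2.2 ⟨0, 1, 0, by simp; rfl⟩)
      (cube_strict_column _ _) (cube_strict_column _ _) (u := ![0, 1, 0]) (v := ![0, 1, 0])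
      (i := 0) (j := 2) (by decide) ?_ ?_).elim <;>
    · rw [coe_elt]
      ext i
      fin_cases i <;> simp [Matrix.mulVec, dotProduct, Fin.sum_univ_three]
  | L3_quarter_1 =>
    refine ⟨-1, rfl, param_relation ?_⟩
    have := h.eq_of_mem (mem_L3_quarter_1.2 ⟨1, 0, 0, by simp⟩)
      (mem_L3_quarter_1.2 ⟨0, 0, 1, rfl⟩)
    linear_combination (1 / 2) * this
  | L3_quarter_2 =>
    -- The coefficient `-1` gives `E₃₁`, because `y₃ = -E₃₁`.
    refine (h.false_of_mem (mem_L3_quarter_2.2 ⟨1, 0, 0, by simp; rfl⟩)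
      (mem_L3_quarter_2.2 ⟨0, -1, 0, by simp; rfl⟩)
      (cube_strictly_lower _ _ _) (cube_strictly_lower _ _ _) (u := ![1, 0, 0]) (v := ![1, 0, 0])
      (i := 1) (j := 2) (by decide) ?_ ?_).elim <;>
    · rw [coe_elt]
      ext i
      fin_cases i <;> simp [Matrix.mulVec, dotProduct, Fin.sum_univ_three]
  | L3_two_ninths =>
    -- One element suffices: the image of the regular nilpotent `x₁ + x₂` is already a plane.
    refine (h.false_of_mem (mem_L3_two_ninths.2 ⟨1, 0, 0, rfl⟩) (mem_L3_two_ninths.2 ⟨1, 0, 0, rfl⟩)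
      (cube_strictly_upper _ _ _) (cube_strictly_upper _ _ _) (u := ![0, 1, 0]) (v := ![0, 0, 1])
      (i := 0) (j := 1) (by decide) ?_ ?_).elim <;>
    · rw [coe_elt]
      ext i
      fin_cases i <;> simp [Matrix.mulVec, dotProduct, Fin.sum_univ_three]
  | L3_zero =>
    -- The nilpotent elements do have a common image line, but no single ratio fits the whole torus:
    -- `h₁` forces `α = 0` and `h₂` forces `α = 1`.
    have h1 := h.eq_of_mem (mem_L3_zero.2 ⟨1, 0, 0, rfl⟩) (mem_L3_zero.2 ⟨0, 1, 0, rfl⟩)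
    have h2 := h.eq_of_mem (mem_L3_zero.2 ⟨1, 0, 0, rfl⟩) (mem_L3_zero.2 ⟨0, 0, 1, rfl⟩)
    grind
  | family₁ β hβ₁ hβ₂ =>
    refine ⟨β, rfl, param_relation ?_⟩
    have := h.eq_of_mem (mem_family₁.2 ⟨1, 0, 0, by simp⟩) (mem_family₁.2 ⟨0, 0, 1, rfl⟩)
    linear_combination (1 / 2) * this
  | family₂ β hβ₁ hβ₂ =>
    refine (h.false_of_mem (mem_family₂.2 ⟨1, 0, 0, by simp; rfl⟩)
      (mem_family₂.2 ⟨0, 1, 0, by simp; rfl⟩)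
      (cube_strict_column _ _) (cube_strict_column _ _) (u := ![0, 1, 0]) (v := ![0, 1, 0])
      (i := 0) (j := 2) (by decide) ?_ ?_).elim <;>
    · rw [coe_elt]
      ext i
      fin_cases i <;> simp [Matrix.mulVec, dotProduct, Fin.sum_univ_three]
  | L4_1 =>
    refine ⟨1, rfl, param_relation ?_⟩
    have := h.eq_of_mem (mem_L4_1.2 ⟨1, 0, 0, rfl⟩) (mem_L4_1.2 ⟨0, 0, 1, rfl⟩)
    linear_combination (1 / 2) * this
  | L4_2 =>
    refine (h.false_of_mem (mem_L4_2.2 ⟨1, 0, 0, rfl⟩) (mem_L4_2.2 ⟨0, 1, 0, rfl⟩)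
      (cube_strict_column _ _) (cube_strict_column _ _) (u := ![0, 1, 0]) (v := ![0, 1, 0])
      (i := 0) (j := 2) (by decide) ?_ ?_).elim <;>
    · rw [coe_elt]
      ext i
      fin_cases i <;> simp [Matrix.mulVec, dotProduct, Fin.sum_univ_three]
  | L5_1 =>
    refine (h.false_of_mem (mem_L5_1.2 ⟨1, 0, 0, rfl⟩) (mem_L5_1.2 ⟨0, 1, 0, rfl⟩)
      (cube_strictly_upper _ _ _) (cube_strictly_upper _ _ _) (u := ![0, 1, 0]) (v := ![0, 0, 1])
      (i := 0) (j := 1) (by decide) ?_ ?_).elim <;>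
    · rw [coe_elt]
      ext i
      fin_cases i <;> simp [Matrix.mulVec, dotProduct, Fin.sum_univ_three]

theorem KernelInv.param {l : Label} {α : ℂ} (h : KernelInv α (subalg l)) :
    ∃ β, kernelParam l = some β ∧ (α = β ∨ α * β = 1) := by
  cases l with
  | L2_1 =>
    refine (h.false_of_mem (mem_L2_1.2 ⟨1, 0, 0, by simp; rfl⟩) (mem_L2_1.2 ⟨0, -1, 0, by simp; rfl⟩)
      (cube_strictly_upper _ _ _) (cube_strictly_upper _ _ _) (u := ![1, 0, 0]) (v := ![1, 0, 0])
      (i := 1) (j := 2) (by decide) ?_ ?_).elim <;>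
    · rw [coe_elt]
      ext i
      fin_cases i <;> simp [Matrix.vecMul, dotProduct, Fin.sum_univ_three]
  | L2_2 =>
    refine ⟨-1, rfl, param_relation ?_⟩
    have := h.eq_of_mem (mem_L2_2.2 ⟨1, 0, 0, by simp⟩) (mem_L2_2.2 ⟨0, 0, 1, rfl⟩)
    linear_combination (1 / 2) * this
  | L3_quarter_1 =>
    refine (h.false_of_mem (mem_L3_quarter_1.2 ⟨1, 0, 0, by simp; rfl⟩)
      (mem_L3_quarter_1.2 ⟨0, -1, 0, by simp; rfl⟩)
      (cube_strictly_upper _ _ _) (cube_strictly_upper _ _ _) (u := ![1, 0, 0]) (v := ![1, 0, 0])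
      (i := 1) (j := 2) (by decide) ?_ ?_).elim <;>
    · rw [coe_elt]
      ext i
      fin_cases i <;> simp [Matrix.vecMul, dotProduct, Fin.sum_univ_three]
  | L3_quarter_2 =>
    refine ⟨-1, rfl, param_relation ?_⟩
    have := h.eq_of_mem_lower (mem_L3_quarter_2.2 ⟨1, 0, 0, by simp⟩)
      (mem_L3_quarter_2.2 ⟨0, 0, 1, rfl⟩)
    linear_combination (1 / 2) * this
  | L3_two_ninths =>
    refine (h.false_of_mem (mem_L3_two_ninths.2 ⟨1, 0, 0, rfl⟩) (mem_L3_two_ninths.2 ⟨1, 0, 0, rfl⟩)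
      (cube_strictly_upper _ _ _) (cube_strictly_upper _ _ _) (u := ![1, 0, 0]) (v := ![0, 1, 0])
      (i := 1) (j := 2) (by decide) ?_ ?_).elim <;>
    · rw [coe_elt]
      ext i
      fin_cases i <;> simp [Matrix.vecMul, dotProduct, Fin.sum_univ_three]
  | L3_zero =>
    have h1 := h.eq_of_mem (mem_L3_zero.2 ⟨1, 0, 0, rfl⟩) (mem_L3_zero.2 ⟨0, 1, 0, rfl⟩)
    -- `h₁ + h₂` has middle diagonal entry zero, which forces `α = 1` against `α = 0` from `h₁`.
    have h2 := h.eq_of_mem (mem_L3_zero.2 ⟨1, 0, 0, rfl⟩) (mem_L3_zero.2 ⟨0, 1, 1, rfl⟩)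
    grind
  | family₁ β hβ₁ hβ₂ =>
    refine (h.false_of_mem (mem_family₁.2 ⟨1, 0, 0, by simp; rfl⟩)
      (mem_family₁.2 ⟨0, -1, 0, by simp; rfl⟩)
      (cube_strictly_upper _ _ _) (cube_strictly_upper _ _ _) (u := ![1, 0, 0]) (v := ![1, 0, 0])
      (i := 1) (j := 2) (by decide) ?_ ?_).elim <;>
    · rw [coe_elt]
      ext i
      fin_cases i <;> simp [Matrix.vecMul, dotProduct, Fin.sum_univ_three]
  | family₂ β hβ₁ hβ₂ =>
    refine ⟨β, rfl, param_relation ?_⟩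
    have := h.eq_of_mem (mem_family₂.2 ⟨1, 0, 0, by simp⟩) (mem_family₂.2 ⟨0, 0, 1, rfl⟩)
    linear_combination (1 / 2) * this
  | L4_1 =>
    refine (h.false_of_mem (mem_L4_1.2 ⟨1, 0, 0, rfl⟩) (mem_L4_1.2 ⟨0, -1, 0, rfl⟩)
      (cube_strictly_upper _ _ _) (cube_strictly_upper _ _ _) (u := ![1, 0, 0]) (v := ![1, 0, 0])
      (i := 1) (j := 2) (by decide) ?_ ?_).elim <;>
    · rw [coe_elt]
      ext i
      fin_cases i <;> simp [Matrix.vecMul, dotProduct, Fin.sum_univ_three]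
  | L4_2 =>
    refine ⟨1, rfl, param_relation ?_⟩
    have := h.eq_of_mem (mem_L4_2.2 ⟨1, 0, 0, rfl⟩) (mem_L4_2.2 ⟨0, 0, 1, rfl⟩)
    linear_combination (1 / 2) * this
  | L5_1 =>
    refine (h.false_of_mem (mem_L5_1.2 ⟨1, 0, 0, rfl⟩) (mem_L5_1.2 ⟨0, 1, 0, rfl⟩)
      (cube_strictly_upper _ _ _) (cube_strictly_upper _ _ _) (u := ![1, 0, 0]) (v := ![0, 1, 0])
      (i := 1) (j := 2) (by decide) ?_ ?_).elim <;>
    · rw [coe_elt]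
      ext i
      fin_cases i <;> simp [Matrix.vecMul, dotProduct, Fin.sum_univ_three]

/-! ### Invariants separating labels with equal or no parameter. -/

theorem allQuadratic_L2_1 : AllQuadratic (subalg .L2_1) := by
  intro X hX
  obtain ⟨a, b, c, rfl⟩ := mem_L2_1.1 hX
  refine ⟨c, ?_⟩
  rw [coe_elt, pow_two]
  ext i j
  fin_cases i <;> fin_cases j <;> simp <;> ring

theorem allQuadratic_L2_2 : AllQuadratic (subalg .L2_2) := by
  intro X hX
  obtain ⟨a, b, c, rfl⟩ := mem_L2_2.1 hX
  refine ⟨-c, ?_⟩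
  rw [coe_elt, pow_two]
  ext i j
  fin_cases i <;> fin_cases j <;> simp <;> ring

/-- This element has a nontrivial Jordan block for `-1`. Concretely, the entry above the diagonal
forces `c = -2`, which contradicts the diagonal entry of the block. -/
theorem not_allQuadratic_of_mem {K : LieSubalgebra ℂ Alg} (h : elt 2 1 0 1 0 0 0 0 ∈ K) :
    ¬ AllQuadratic K := by
  intro hK
  obtain ⟨c, hc⟩ := hK _ h
  rw [coe_elt, pow_two] at hc
  have h1 := congrFun (congrFun hc 1) 2
  have h2 := congrFun (congrFun hc 1) 1
  simp at h1 h2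
  rw [← h1] at h2
  norm_num at h2

theorem hasRegularNil_of_mem {K : LieSubalgebra ℂ Alg} (h : elt 0 0 1 1 0 0 0 0 ∈ K) :
    HasRegularNil K := by
  refine ⟨_, h, cube_strictly_upper _ _ _, fun h0 => ?_⟩
  rw [coe_elt, pow_two] at h0
  have := congrFun (congrFun h0 0) 2
  simp at this

theorem not_hasRegularNil_L3_zero : ¬ HasRegularNil (subalg .L3_zero) := by
  rintro ⟨X, hX, h3, h2⟩
  obtain ⟨a, b, c, rfl⟩ := mem_L3_zero.1 hX
  obtain ⟨rfl, rfl⟩ := cube_upper h3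
  apply h2
  rw [coe_elt, pow_two]
  ext i j
  fin_cases i <;> fin_cases j <;> simp

theorem allNil_L5_1 : AllNil (subalg .L5_1) := by
  intro X hX
  obtain ⟨a, b, c, rfl⟩ := mem_L5_1.1 hX
  exact cube_strictly_upper _ _ _

theorem not_allNil_L3_two_ninths : ¬ AllNil (subalg .L3_two_ninths) := by
  intro h
  have := cube_upper (h _ (mem_L3_two_ninths.2 ⟨0, 0, 1, rfl⟩))
  exact one_ne_zero this.1

/-! ### Inequivalence of the listed subalgebras -/

theorem imageParam_eq_some {l : Label} {α : ℂ} (h : imageParam l = some α) :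
    (l = .L2_1 ∧ α = -1) ∨ (l = .L3_quarter_1 ∧ α = -1) ∨ (l = .L4_1 ∧ α = 1) ∨
      ∃ h1 h2, l = .family₁ α h1 h2 := by
  cases l <;> simp [imageParam] at h <;> subst h <;> simp [*]

theorem kernelParam_eq_some {l : Label} {α : ℂ} (h : kernelParam l = some α) :
    (l = .L2_2 ∧ α = -1) ∨ (l = .L3_quarter_2 ∧ α = -1) ∨ (l = .L4_2 ∧ α = 1) ∨
      ∃ h1 h2, l = .family₂ α h1 h2 := by
  cases l <;> simp [kernelParam] at h <;> subst h <;> simp [*]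

theorem param_none {l : Label} (h : imageParam l = none) (h' : kernelParam l = none) :
    l = .L3_two_ninths ∨ l = .L3_zero ∨ l = .L5_1 := by
  cases l <;> simp [imageParam, kernelParam] at h h' ⊢

theorem imageParam_of_equiv {l l' : Label} (h : InnerEquivalent (subalg l) (subalg l')) {α : ℂ}
    (hl : imageParam l = some α) : ∃ β, imageParam l' = some β ∧ (α = β ∨ α * β = 1) :=
  ((imageInv_of_param hl).of_equiv h).param

theorem kernelParam_of_equiv {l l' : Label} (h : InnerEquivalent (subalg l) (subalg l')) {α : ℂ}
    (hl : kernelParam l = some α) : ∃ β, kernelParam l' = some β ∧ (α = β ∨ α * β = 1) :=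
  ((kernelInv_of_param hl).of_equiv h).param

theorem neg_one_relation {β : ℂ} (h : -1 = β ∨ -1 * β = 1) : β = -1 := by
  rcases h with h | h
  · exact h.symm
  · linear_combination -h

theorem one_relation {β : ℂ} (h : 1 = β ∨ 1 * β = 1) : β = 1 := by
  rcases h with h | h
  · exact h.symm
  · linear_combination h

theorem eq_of_equiv (l l' : Label) (h : InnerEquivalent (subalg l) (subalg l')) :
    l = l' ∨
      (∃ α hα₁ hα₂ β hβ₁ hβ₂, l = .family₁ α hα₁ hα₂ ∧ l' = .family₁ β hβ₁ hβ₂) ∨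
      (∃ α hα₁ hα₂ β hβ₁ hβ₂, l = .family₂ α hα₁ hα₂ ∧ l' = .family₂ β hβ₁ hβ₂) := by
  have h' := innerEquivalent_symm h
  have nq1 : ¬ AllQuadratic (subalg .L3_quarter_1) :=
    not_allQuadratic_of_mem (mem_L3_quarter_1.2 ⟨0, 0, 1, by simp⟩)
  have nq2 : ¬ AllQuadratic (subalg .L3_quarter_2) :=
    not_allQuadratic_of_mem (mem_L3_quarter_2.2 ⟨0, 0, 1, by simp⟩)
  have r1 : HasRegularNil (subalg .L3_two_ninths) :=
    hasRegularNil_of_mem (mem_L3_two_ninths.2 ⟨1, 0, 0, rfl⟩)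
  have r2 : HasRegularNil (subalg .L5_1) := hasRegularNil_of_mem (mem_L5_1.2 ⟨1, 1, 0, rfl⟩)
  have neg1 : (-1 : ℂ) ≠ 1 := by norm_num
  cases hi : imageParam l with
  | some α =>
    obtain ⟨β, hβ, hαβ⟩ := imageParam_of_equiv h hi
    rcases imageParam_eq_some hi with ⟨rfl, rfl⟩ | ⟨rfl, rfl⟩ | ⟨rfl, rfl⟩ | ⟨h1, h2, rfl⟩
    · obtain rfl := neg_one_relation hαβ
      rcases imageParam_eq_some hβ with ⟨rfl, -⟩ | ⟨rfl, -⟩ | ⟨rfl, hb⟩ | ⟨h1, h2, rfl⟩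
      exacts [.inl rfl, (nq1 (allQuadratic_L2_1.of_equiv h)).elim, (neg1 hb).elim, (h2 rfl).elim]
    · obtain rfl := neg_one_relation hαβ
      rcases imageParam_eq_some hβ with ⟨rfl, -⟩ | ⟨rfl, -⟩ | ⟨rfl, hb⟩ | ⟨h1, h2, rfl⟩
      exacts [(nq1 (allQuadratic_L2_1.of_equiv h')).elim, .inl rfl, (neg1 hb).elim, (h2 rfl).elim]
    · obtain rfl := one_relation hαβ
      rcases imageParam_eq_some hβ with ⟨rfl, hb⟩ | ⟨rfl, hb⟩ | ⟨rfl, -⟩ | ⟨h1, h2, rfl⟩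
      exacts [(neg1 hb.symm).elim, (neg1 hb.symm).elim, .inl rfl, (h1 rfl).elim]
    · rcases imageParam_eq_some hβ with ⟨rfl, rfl⟩ | ⟨rfl, rfl⟩ | ⟨rfl, rfl⟩ | ⟨h3, h4, rfl⟩
      · exact (h2 (hαβ.elim id fun h => by linear_combination -h)).elim
      · exact (h2 (hαβ.elim id fun h => by linear_combination -h)).elim
      · exact (h1 (hαβ.elim id fun h => by linear_combination h)).elim
      · exact .inr (.inl ⟨_, _, _, _, _, _, rfl, rfl⟩)
  | none =>
    cases hk : kernelParam l with
    | some α =>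
      obtain ⟨β, hβ, hαβ⟩ := kernelParam_of_equiv h hk
      rcases kernelParam_eq_some hk with ⟨rfl, rfl⟩ | ⟨rfl, rfl⟩ | ⟨rfl, rfl⟩ | ⟨h1, h2, rfl⟩
      · obtain rfl := neg_one_relation hαβ
        rcases kernelParam_eq_some hβ with ⟨rfl, -⟩ | ⟨rfl, -⟩ | ⟨rfl, hb⟩ | ⟨h1, h2, rfl⟩
        exacts [.inl rfl, (nq2 (allQuadratic_L2_2.of_equiv h)).elim, (neg1 hb).elim, (h2 rfl).elim]
      · obtain rfl := neg_one_relation hαβ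
        rcases kernelParam_eq_some hβ with ⟨rfl, -⟩ | ⟨rfl, -⟩ | ⟨rfl, hb⟩ | ⟨h1, h2, rfl⟩
        exacts [(nq2 (allQuadratic_L2_2.of_equiv h')).elim, .inl rfl, (neg1 hb).elim,
          (h2 rfl).elim]
      · obtain rfl := one_relation hαβ
        rcases kernelParam_eq_some hβ with ⟨rfl, hb⟩ | ⟨rfl, hb⟩ | ⟨rfl, -⟩ | ⟨h1, h2, rfl⟩
        exacts [(neg1 hb.symm).elim, (neg1 hb.symm).elim, .inl rfl, (h1 rfl).elim]
      · rcases kernelParam_eq_some hβ with ⟨rfl, rfl⟩ | ⟨rfl, rfl⟩ | ⟨rfl, rfl⟩ | ⟨h3, h4, rfl⟩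
        · exact (h2 (hαβ.elim id fun h => by linear_combination -h)).elim
        · exact (h2 (hαβ.elim id fun h => by linear_combination -h)).elim
        · exact (h1 (hαβ.elim id fun h => by linear_combination h)).elim
        · exact .inr (.inr ⟨_, _, _, _, _, _, rfl, rfl⟩)
    | none =>
      have hi' : imageParam l' = none := by
        by_contra hne
        obtain ⟨β, hβ⟩ := Option.ne_none_iff_exists'.1 hne
        obtain ⟨γ, hγ, -⟩ := imageParam_of_equiv h' hβ
        simp [hi] at hγ
      have hk' : kernelParam l' = none := by
        by_contra hne
        obtain ⟨β, hβ⟩ := Option.ne_none_iff_exists'.1 hne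
        obtain ⟨γ, hγ, -⟩ := kernelParam_of_equiv h' hβ
        simp [hk] at hγ
      left
      rcases param_none hi hk with rfl | rfl | rfl <;>
        rcases param_none hi' hk' with rfl | rfl | rfl
      · rfl
      · exact (not_hasRegularNil_L3_zero (r1.of_equiv h)).elim
      · exact (not_allNil_L3_two_ninths (allNil_L5_1.of_equiv h')).elim
      · exact (not_hasRegularNil_L3_zero (r1.of_equiv h')).elim
      · rfl
      · exact (not_hasRegularNil_L3_zero (r2.of_equiv h')).elim
      · exact (not_allNil_L3_two_ninths (allNil_L5_1.of_equiv h)).elim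
      · exact (not_hasRegularNil_L3_zero (r2.of_equiv h)).elim
      · rfl

/-! ### Equivalences within the families -/

/-- An invertible matrix conjugating three generators into `K` shows that `K` is equivalent to the
subalgebra they generate. -/
theorem innerEquivalent_of_le {l : Label} {K : LieSubalgebra ℂ Alg}
    (hK : Module.finrank ℂ K = 3) (P : M3ˣ)
    (h : ∀ X ∈ subalg l, conj P X ∈ K) : InnerEquivalent (subalg l) K := by
  refine innerEquivalent_iff.2 ⟨P, ?_⟩
  have hle : (subalg l).map (conj P : Alg →ₗ⁅ℂ⁆ Alg) ≤ K := by
    rintro _ ⟨X, hX, rfl⟩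
    exact h X hX
  have hfr : Module.finrank ℂ ((subalg l).map (conj P : Alg →ₗ⁅ℂ⁆ Alg)) = 3 :=
    (LinearEquiv.finrank_eq
      ((conj P).toLinearEquiv.submoduleMap (subalg l).toSubmodule)).symm.trans
      (listed_properties l).1
  rw [← LieSubalgebra.toSubmodule_inj]
  exact Submodule.eq_of_le_of_finrank_le ((LieSubalgebra.toSubmodule_le_toSubmodule _ _).2 hle)
    (le_of_eq (hK.trans hfr.symm))

/-! ### Recognizing the listed subalgebras up to conjugation -/

/-- `K` is equivalent to a listed subalgebra. -/
def Classified (K : LieSubalgebra ℂ Alg) : Prop := ∃ l : Label, InnerEquivalent K (subalg l)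

theorem Classified.of_map {K : LieSubalgebra ℂ Alg} (P : M3ˣ)
    (h : Classified (K.map (conj P : Alg →ₗ⁅ℂ⁆ Alg))) : Classified K := by
  obtain ⟨l, hl⟩ := h
  exact ⟨l, innerEquivalent_trans (innerEquivalent_iff.2 ⟨P, rfl⟩) hl⟩

/-- The columns of `A` are a basis in which `u'`, `v'`, `w'` take the form of the generators. The
intertwining form avoids inverses, and equality of dimensions makes checking three elements enough.
-/
theorem innerEquivalent_of_conj (l : Label) {u v w : Alg} (hl : subalg l = gen u v w)
    {K : LieSubalgebra ℂ Alg} (hK : Module.finrank ℂ K = 3) (A : M3) (hA : A.det ≠ 0)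
    {u' v' w' : Alg} (hu : u' ∈ K) (hv : v' ∈ K) (hw : w' ∈ K) (hAu : A * (u : M3) = u' * A)
    (hAv : A * (v : M3) = v' * A) (hAw : A * (w : M3) = w' * A) :
    InnerEquivalent (subalg l) K := by
  refine innerEquivalent_of_le hK (Matrix.GeneralLinearGroup.mkOfDetNeZero A hA) ?_
  rw [hl]
  have h : gen u v w ≤ K.comap (conj (Matrix.GeneralLinearGroup.mkOfDetNeZero A hA) :
      Alg →ₗ⁅ℂ⁆ Alg) := by
    refine LieSubalgebra.lieSpan_le.2 ?_
    rintro X (rfl | rfl | rfl)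
    · rwa [← (conj_eq_iff (Matrix.GeneralLinearGroup.mkOfDetNeZero A hA) _ _).2 hAu] at hu
    · rwa [← (conj_eq_iff (Matrix.GeneralLinearGroup.mkOfDetNeZero A hA) _ _).2 hAv] at hv
    · rwa [← (conj_eq_iff (Matrix.GeneralLinearGroup.mkOfDetNeZero A hA) _ _).2 hAw] at hw
  exact fun X hX => h hX

theorem classified_of_conj (l : Label) {u v w : Alg} (hl : subalg l = gen u v w)
    {K : LieSubalgebra ℂ Alg} (hK : Module.finrank ℂ K = 3) (A : M3) (hA : A.det ≠ 0)
    {u' v' w' : Alg} (hu : u' ∈ K) (hv : v' ∈ K) (hw : w' ∈ K) (hAu : A * (u : M3) = u' * A)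
    (hAv : A * (v : M3) = v' * A) (hAw : A * (w : M3) = w' * A) : Classified K :=
  ⟨l, innerEquivalent_symm (innerEquivalent_of_conj l hl hK A hA hu hv hw hAu hAv hAw)⟩

theorem mem_of_eq {K : LieSubalgebra ℂ Alg} {X Y : Alg} (h : X ∈ K) (e : X = Y) : Y ∈ K := e ▸ h

-- The case distinction is by the lower right block of `s`, with diagonal `b - a`, `-b` and
-- off-diagonal entry `d`. Equal eigenvalues (`a = 2b`) give `L2_1` or `L3_quarter_1`; otherwise the
-- block is diagonalized and `s` rescaled to `diag(α - 1, 1, -α)`, or to `h₂` if `a = 0`.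
set_option maxHeartbeats 1000000 in
theorem classified_row {K : LieSubalgebra ℂ Alg} (hK : Module.finrank ℂ K = 3)
    (h12 : elt 0 0 1 0 0 0 0 0 ∈ K) (h13 : elt 0 0 0 0 1 0 0 0 ∈ K) {a b d : ℂ}
    (hs : elt a b 0 d 0 0 0 0 ∈ K) (hab : a ≠ 0 ∨ b ≠ 0) : Classified K := by
  have hv : ∀ t r : ℂ, elt 0 0 r 0 t 0 0 0 ∈ K := fun t r =>
    mem_of_eq (K.add_mem (K.smul_mem r h12) (K.smul_mem t h13)) (by simp [elt_add, elt_smul])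
  have hw : ∀ r : ℂ, elt (r * a) (r * b) 0 (r * d) 0 0 0 0 ∈ K := fun r =>
    mem_of_eq (K.smul_mem r hs) (by simp [elt_smul])
  by_cases h2 : a = 2 * b
  · subst h2
    have hb : b ≠ 0 := by simpa using hab
    by_cases hd : d = 0
    · subst hd
      refine classified_of_conj .L2_1 rfl hK 1 (by simp) (hv 0 1) (hv 1 0) (hw b⁻¹)
        (by rw [one_mul, mul_one]; rfl) (by rw [one_mul, mul_one]; rfl) ?_
      simp only [one_mul, mul_one, h₁, h₂, elt_smul, elt_add, coe_elt]
      ext i j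
      fin_cases i <;> fin_cases j <;> simp <;> grind
    · refine classified_of_conj .L3_quarter_1 rfl hK !![1, 0, 0; 0, d / b, 0; 0, 0, 1]
        (by simp [Matrix.det_fin_three, hd, hb]) (hv 0 (b / d)) (hv 1 0) (hw b⁻¹) ?_ ?_ ?_ <;>
      · simp only [x₁, x₂, x₃, h₁, h₂, elt_smul, elt_add, coe_elt]
        ext i j
        fin_cases i <;> fin_cases j <;> simp <;> grind
  by_cases h1 : b = a
  · subst h1
    have hb : b ≠ 0 := by simpa using hab
    -- The middle entry of `s` is zero and cannot be scaled to one, so the last two basis vectors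
    -- are also interchanged.
    refine classified_of_conj (.family₁ 0 (by norm_num) (by norm_num)) rfl hK
      !![1, 0, 0; 0, -(d / b), 1; 0, 1, 0] (by simp [Matrix.det_fin_three]) (hv (-1) 0)
      (hv (d / b) (-1)) (hw (-b⁻¹)) ?_ ?_ ?_ <;>
    · simp only [x₁, x₃, h₁, h₂, elt_smul, elt_add, coe_elt]
      ext i j
      fin_cases i <;> fin_cases j <;> simp <;> grind
  have h1' : b - a ≠ 0 := sub_ne_zero.2 h1
  have h2' : 2 * b - a ≠ 0 := sub_ne_zero.2 (Ne.symm h2)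
  by_cases ha : a = 0
  · subst ha
    have hb : b ≠ 0 := by simpa using hab
    refine classified_of_conj .L4_1 rfl hK
      !![1, 0, 0; 0, 1, -(d / (2 * b)); 0, 0, 1] (by simp [Matrix.det_fin_three])
      (hv (-(d / (2 * b))) 1) (hv 1 0) (hw b⁻¹) ?_ ?_ ?_ <;>
    · simp only [x₁, x₃, h₂, coe_elt]
      ext i j
      fin_cases i <;> fin_cases j <;> simp <;> grind
  · refine classified_of_conj (.family₁ (b / (b - a)) (by grind) (by grind)) rfl hK
      !![1, 0, 0; 0, 1, -(d / (2 * b - a)); 0, 0, 1] (by simp [Matrix.det_fin_three])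
      (hv (-(d / (2 * b - a))) 1) (hv 1 0) (hw (b - a)⁻¹) ?_ ?_ ?_ <;>
    · simp only [x₁, x₃, h₁, h₂, elt_smul, elt_add, coe_elt]
      ext i j
      fin_cases i <;> fin_cases j <;> simp <;> grind

-- Dual to `classified_row`, using the upper left block with diagonal `a`, `b - a`. The bases are
-- permuted because the listed algebras have their nilpotents in the second column, or in the first
-- for `L3_quarter_2`.
set_option maxHeartbeats 1000000 in
theorem classified_column {K : LieSubalgebra ℂ Alg} (hK : Module.finrank ℂ K = 3)
    (h23 : elt 0 0 0 1 0 0 0 0 ∈ K) (h13 : elt 0 0 0 0 1 0 0 0 ∈ K) {a b c : ℂ}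
    (hs : elt a b c 0 0 0 0 0 ∈ K) (hab : a ≠ 0 ∨ b ≠ 0) : Classified K := by
  have hv : ∀ t r : ℂ, elt 0 0 0 r t 0 0 0 ∈ K := fun t r =>
    mem_of_eq (K.add_mem (K.smul_mem r h23) (K.smul_mem t h13)) (by simp [elt_add, elt_smul])
  have hw : ∀ r : ℂ, elt (r * a) (r * b) (r * c) 0 0 0 0 0 ∈ K := fun r =>
    mem_of_eq (K.smul_mem r hs) (by simp [elt_smul])
  by_cases h2 : b = 2 * a
  · subst h2
    have ha : a ≠ 0 := by simpa using hab
    by_cases hc : c = 0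
    · subst hc
      refine classified_of_conj .L2_2 rfl hK !![1, 0, 0; 0, 0, 1; 0, 1, 0]
        (by simp [Matrix.det_fin_three]) (hv (-1) 0) (hv 0 1) (hw a⁻¹) ?_ ?_ ?_ <;>
      · simp only [x₁, y₂, h₁, h₂, elt_sub, coe_elt]
        ext i j
        fin_cases i <;> fin_cases j <;> simp <;> grind
    · refine classified_of_conj .L3_quarter_2 rfl hK !![0, -(c / a), 0; 0, 0, 1; 1, 0, 0]
        (by simp [Matrix.det_fin_three, hc, ha]) (hv (c / a) 0) (hv 0 (-1)) (hw (-a⁻¹))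
        ?_ ?_ ?_ <;>
      · simp only [y₁, x₂, y₃, h₁, h₂, elt_smul, elt_add, coe_elt]
        ext i j
        fin_cases i <;> fin_cases j <;> simp <;> grind
  have h2' : b - 2 * a ≠ 0 := sub_ne_zero.2 h2
  by_cases ha : a = 0
  · subst ha
    have hb : b ≠ 0 := by simpa using hab
    refine classified_of_conj (.family₂ 0 (by norm_num) (by norm_num)) rfl hK
      !![c / b, 0, 1; 1, 0, 0; 0, 1, 0] (by simp [Matrix.det_fin_three]) (hv (-(c / b)) 1)
      (hv (-1) 0) (hw b⁻¹) ?_ ?_ ?_ <;>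
    · simp only [x₁, y₂, h₁, h₂, elt_smul, elt_add, coe_elt]
      ext i j
      fin_cases i <;> fin_cases j <;> simp <;> grind
  by_cases hb : b = 0
  · subst hb
    refine classified_of_conj .L4_2 rfl hK
      !![1, 0, -(c / (2 * a)); 0, 0, 1; 0, 1, 0] (by simp [Matrix.det_fin_three])
      (hv (-1) 0) (hv (c / (2 * a)) 1) (hw a⁻¹) ?_ ?_ ?_ <;>
    · simp only [x₁, y₂, h₁, h₂, elt_add, coe_elt]
      ext i j
      fin_cases i <;> fin_cases j <;> simp <;> grind
  -- After exchanging the last two basis vectors and dividing by `a`, the diagonal is `(1, -b/a, (b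
  -- - a)/a)`, to be matched with `(1, α - 1, -α)`.
  · refine classified_of_conj (.family₂ ((a - b) / a) (by grind) (by grind)) rfl hK
      !![1, 0, c / (b - 2 * a); 0, 0, 1; 0, 1, 0] (by simp [Matrix.det_fin_three])
      (hv (-1) 0) (hv (-(c / (b - 2 * a))) 1) (hw a⁻¹) ?_ ?_ ?_ <;>
    · simp only [x₁, y₂, h₁, h₂, elt_smul, elt_add, coe_elt]
      ext i j
      fin_cases i <;> fin_cases j <;> simp <;> grind

theorem classified_mixed {K : LieSubalgebra ℂ Alg} (hK : Module.finrank ℂ K = 3) {p q r c : ℂ}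
    (hp : p ≠ 0) (hq : q ≠ 0) (hr : r ≠ 0)
    (hz : elt 0 0 p q 0 0 0 0 ∈ K) (h13 : elt 0 0 0 0 1 0 0 0 ∈ K)
    (hs : elt r r c 0 0 0 0 0 ∈ K) : Classified K := by
  have hz' : elt 0 0 p q (c / r * q) 0 0 0 ∈ K :=
    mem_of_eq (K.add_mem hz (K.smul_mem (c / r * q) h13)) (by simp [elt_add, elt_smul])
  have h13' : elt 0 0 0 0 (p * q) 0 0 0 ∈ K :=
    mem_of_eq (K.smul_mem (p * q) h13) (by simp [elt_smul])
  refine classified_of_conj .L3_two_ninths rfl hK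
    !![p, -(c / r), 0; 0, 1, 0; 0, 0, q⁻¹] (by simp [Matrix.det_fin_three, hp, hq])
    hz' h13' (K.smul_mem r⁻¹ hs) ?_ ?_ ?_ <;>
  · simp only [x₁, x₂, x₃, h₁, h₂, elt_smul, elt_add, coe_elt]
    ext i j
    fin_cases i <;> fin_cases j <;> simp <;> grind

theorem classified_torus {K : LieSubalgebra ℂ Alg} (hK : Module.finrank ℂ K = 3)
    (hd : ∀ a b : ℂ, elt a b 0 0 0 0 0 0 ∈ K) (h : elt 0 0 1 0 0 0 0 0 ∈ K ∨
      elt 0 0 0 1 0 0 0 0 ∈ K ∨ elt 0 0 0 0 1 0 0 0 ∈ K) : Classified K := by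
  rcases h with h | h | h
  · refine classified_of_conj .L3_zero rfl hK 1 (by simp) h (hd 1 0) (hd 0 1) ?_ ?_ ?_ <;>
    · rw [one_mul, mul_one]
      rfl
  · refine classified_of_conj .L3_zero rfl hK !![0, 0, 1; 1, 0, 0; 0, 1, 0]
      (by simp [Matrix.det_fin_three]) h (hd 0 1) (hd (-1) (-1)) ?_ ?_ ?_ <;>
    · simp only [x₁, h₁, h₂, coe_elt]
      ext i j
      fin_cases i <;> fin_cases j <;> simp
  · refine classified_of_conj .L3_zero rfl hK !![1, 0, 0; 0, 0, 1; 0, 1, 0]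
      (by simp [Matrix.det_fin_three]) (K.smul_mem (-1) h) (hd 1 1) (hd 0 (-1)) ?_ ?_ ?_ <;>
    · simp only [x₁, h₁, h₂, coe_elt, elt_smul]
      ext i j
      fin_cases i <;> fin_cases j <;> simp

/-! ### Equivalences within the families -/

theorem innerEquivalent_refl (K : LieSubalgebra ℂ Alg) : InnerEquivalent K K := by
  refine ⟨LieEquiv.refl, .refl, ?_⟩
  ext X
  constructor
  · rintro ⟨Y, hY, rfl⟩
    exact hY
  · intro hX
    exact ⟨X, hX, rfl⟩

theorem family₁_equiv_iff {α β : ℂ} (hα₁ : α ≠ 1) (hα₂ : α ≠ -1) (hβ₁ : β ≠ 1) (hβ₂ : β ≠ -1) :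
    InnerEquivalent (subalg (.family₁ α hα₁ hα₂)) (subalg (.family₁ β hβ₁ hβ₂)) ↔
      α = β ∨ α * β = 1 := by
  constructor
  · intro h
    obtain ⟨γ, hγ, h'⟩ := imageParam_of_equiv h (α := α) rfl
    obtain rfl : β = γ := by simpa [imageParam] using hγ
    exact h'
  · rintro (rfl | h)
    · exact innerEquivalent_refl _
    -- Exchanging `e₂` and `e₃` turns `diag(α - 1, 1, -α)` into `-α diag(β - 1, 1, -β)` when `αβ =
    -- 1`.
    · refine innerEquivalent_of_conj _ rfl (listed_properties _).1 !![1, 0, 0; 0, 0, 1; 0, 1, 0]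
        (by simp [Matrix.det_fin_three]) (mem_family₁.2 ⟨0, -1, 0, rfl⟩)
        (mem_family₁.2 ⟨-1, 0, 0, rfl⟩) (mem_family₁.2 ⟨0, 0, -α, rfl⟩) ?_ ?_ ?_ <;>
      · simp only [x₁, x₃, h₁, h₂, elt_smul, elt_add, coe_elt]
        ext i j
        fin_cases i <;> fin_cases j <;> simp <;> grind

theorem family₂_equiv_iff {α β : ℂ} (hα₁ : α ≠ 1) (hα₂ : α ≠ -1) (hβ₁ : β ≠ 1) (hβ₂ : β ≠ -1) :
    InnerEquivalent (subalg (.family₂ α hα₁ hα₂)) (subalg (.family₂ β hβ₁ hβ₂)) ↔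
      α = β ∨ α * β = 1 := by
  constructor
  · intro h
    obtain ⟨γ, hγ, h'⟩ := kernelParam_of_equiv h (α := α) rfl
    obtain rfl : β = γ := by simpa [kernelParam] using hγ
    exact h'
  · rintro (rfl | h)
    · exact innerEquivalent_refl _
    · refine innerEquivalent_of_conj _ rfl (listed_properties _).1 !![0, 0, 1; 0, 1, 0; 1, 0, 0]
        (by simp [Matrix.det_fin_three]) (mem_family₂.2 ⟨0, 1, 0, rfl⟩)
        (mem_family₂.2 ⟨1, 0, 0, rfl⟩) (mem_family₂.2 ⟨0, 0, -α, rfl⟩) ?_ ?_ ?_ <;>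
      · simp only [x₁, y₂, h₁, h₂, elt_smul, elt_add, coe_elt]
        ext i j
        fin_cases i <;> fin_cases j <;> simp <;> grind

/-! ### Simultaneous triangularization -/

/-- Lie's theorem for matrices: `ρ` makes `ℂⁿ` a Lie module over a solvable algebra, which has a
nonzero weight space. -/
theorem exists_common_eigenvector {L : Type*} [LieRing L] [LieAlgebra ℂ L] [LieAlgebra.IsSolvable L]
    {n : ℕ} [NeZero n] (ρ : L →ₗ[ℂ] Matrix (Fin n) (Fin n) ℂ)
    (hρ : ∀ x y, ρ ⁅x, y⁆ = ρ x * ρ y - ρ y * ρ x) :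
    ∃ v : Fin n → ℂ, v ≠ 0 ∧ ∀ x, ∃ c : ℂ, ρ x *ᵥ v = c • v := by
  let : LieRingModule L (Fin n → ℂ) :=
    { bracket := fun x v => ρ x *ᵥ v
      add_lie := fun x y v => by
        change ρ (x + y) *ᵥ v = ρ x *ᵥ v + ρ y *ᵥ v
        rw [map_add, Matrix.add_mulVec]
      lie_add := fun x v w => Matrix.mulVec_add _ _ _
      leibniz_lie := fun x y v => by
        change ρ x *ᵥ ρ y *ᵥ v = ρ ⁅x, y⁆ *ᵥ v + ρ y *ᵥ ρ x *ᵥ v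
        rw [hρ, Matrix.sub_mulVec, Matrix.mulVec_mulVec, Matrix.mulVec_mulVec, sub_add_cancel] }
  have : LieModule ℂ L (Fin n → ℂ) :=
    { smul_lie := fun t x v => by
        change ρ (t • x) *ᵥ v = t • ρ x *ᵥ v
        rw [map_smul, Matrix.smul_mulVec]
      lie_smul := fun t x v => Matrix.mulVec_smul _ _ _ }
  obtain ⟨χ, hχ⟩ := LieModule.exists_nontrivial_weightSpace_of_isSolvable ℂ L (Fin n → ℂ)
  obtain ⟨⟨v, hv⟩, hv0⟩ := exists_ne (0 : LieModule.weightSpace (Fin n → ℂ) χ)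
  refine ⟨v, fun h => hv0 (Subtype.ext h), fun x => ⟨χ x, ?_⟩⟩
  exact (LieModule.mem_weightSpace (M := Fin n → ℂ) χ v).1 hv x

theorem exists_unit_col_three {v : Fin 3 → ℂ} (hv : v ≠ 0) :
    ∃ P : M3ˣ, (P : M3) *ᵥ Pi.single 0 1 = v := by
  have key : ∀ A : M3, A.det ≠ 0 → (∀ i, A i 0 = v i) → ∃ P : M3ˣ, (P : M3) *ᵥ Pi.single 0 1 = v :=
    fun A hA h => ⟨Matrix.GeneralLinearGroup.mkOfDetNeZero A hA, by
      rw [Matrix.mulVec_single_one]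
      exact funext h⟩
  by_cases h0 : v 0 = 0
  · by_cases h1 : v 1 = 0
    · have h2 : v 2 ≠ 0 := fun h2 => hv (funext fun i => by fin_cases i <;> assumption)
      refine key !![v 0, 1, 0; v 1, 0, 1; v 2, 0, 0] (by simpa [Matrix.det_fin_three]) fun i => ?_
      fin_cases i <;> rfl
    · refine key !![v 0, 1, 0; v 1, 0, 0; v 2, 0, 1] (by simpa [Matrix.det_fin_three]) fun i => ?_
      fin_cases i <;> rfl
  · refine key !![v 0, 0, 0; v 1, 1, 0; v 2, 0, 1] (by simpa [Matrix.det_fin_three]) fun i => ?_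
    fin_cases i <;> rfl

instance isSolvable_map_conj (K : LieSubalgebra ℂ Alg) [LieAlgebra.IsSolvable K] (P : M3ˣ) :
    LieAlgebra.IsSolvable (K.map (conj P : Alg →ₗ⁅ℂ⁆ Alg)) :=
  Function.Surjective.lieAlgebra_isSolvable
    (f := (LieEquiv.lieSubalgebraMap K (conj P) : K →ₗ⁅ℂ⁆ _))
    (LieEquiv.surjective _)

theorem finrank_map_conj (K : LieSubalgebra ℂ Alg) (P : M3ˣ) :
    Module.finrank ℂ (K.map (conj P : Alg →ₗ⁅ℂ⁆ Alg)) = Module.finrank ℂ K :=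
  (LinearEquiv.finrank_eq ((conj P).toLinearEquiv.submoduleMap K.toSubmodule)).symm

theorem map_conj_mul (K : LieSubalgebra ℂ Alg) (P Q : M3ˣ) :
    (K.map (conj P : Alg →ₗ⁅ℂ⁆ Alg)).map (conj Q : Alg →ₗ⁅ℂ⁆ Alg) =
      K.map (conj (Q * P) : Alg →ₗ⁅ℂ⁆ Alg) := by
  rw [conj_mul]
  ext X
  constructor
  · rintro ⟨_, ⟨Y, hY, rfl⟩, rfl⟩
    exact ⟨Y, hY, rfl⟩
  · rintro ⟨Y, hY, rfl⟩
    exact ⟨_, ⟨Y, hY, rfl⟩, rfl⟩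

/-- Members of `K.map (conj P⁻¹)` are described without inverses. -/
theorem mem_map_conj_inv {K : LieSubalgebra ℂ Alg} {P : M3ˣ} {Y : Alg} :
    Y ∈ K.map (conj P⁻¹ : Alg →ₗ⁅ℂ⁆ Alg) ↔ ∃ X ∈ K, (P : M3) * Y = X * P := by
  rw [mem_map_conj]
  refine exists_congr fun X => and_congr_right fun _ => ?_
  rw [inv_inv, mul_assoc, Units.eq_inv_mul_iff_mul_eq]

theorem exists_first_column (K : LieSubalgebra ℂ Alg) [LieAlgebra.IsSolvable K] :
    ∃ P : M3ˣ, ∀ X ∈ K.map (conj P : Alg →ₗ⁅ℂ⁆ Alg), (X : M3) 1 0 = 0 ∧ (X : M3) 2 0 = 0 := by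
  obtain ⟨v, hv0, hv⟩ := exists_common_eigenvector (L := K)
    { toFun := fun X => ((X : Alg) : M3), map_add' := fun _ _ => rfl, map_smul' := fun _ _ => rfl }
    (fun X Y => coe_lie X Y)
  obtain ⟨P, hP⟩ := exists_unit_col_three hv0
  refine ⟨P⁻¹, fun Y hY => ?_⟩
  obtain ⟨X, hX, h⟩ := mem_map_conj_inv.1 hY
  obtain ⟨c, hc⟩ := hv ⟨X, hX⟩
  have hc' : (X : M3) *ᵥ v = c • v := hc
  have h1 : (P : M3) *ᵥ ((Y : M3) *ᵥ Pi.single 0 1) = (P : M3) *ᵥ (c • Pi.single 0 1) := by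
    rw [Matrix.mulVec_mulVec, h, ← Matrix.mulVec_mulVec, hP, hc', Matrix.mulVec_smul, hP]
  have h2 := Matrix.mulVec_injective_of_isUnit P.isUnit h1
  rw [Matrix.mulVec_single_one] at h2
  exact ⟨by simpa using congrFun h2 1, by simpa using congrFun h2 2⟩

/-- The lower right `2 × 2` block. -/
def lowerBlock (A : M3) : Matrix (Fin 2) (Fin 2) ℂ := A.submatrix Fin.succ Fin.succ

theorem lowerBlock_mul (A B : M3) (hA : A 1 0 = 0 ∧ A 2 0 = 0) :
    lowerBlock (A * B) = lowerBlock A * lowerBlock B := by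
  ext i j
  fin_cases i <;> simp [lowerBlock, Matrix.mul_apply, Fin.sum_univ_succ, hA.1, hA.2]

/-- After the first column is cleared, the lower right block is again a representation of the
solvable algebra. A common eigenvector `w` of it, placed as second basis vector, clears the
remaining entry. -/
theorem exists_triangular (K : LieSubalgebra ℂ Alg) [LieAlgebra.IsSolvable K] :
    ∃ P : M3ˣ, ∀ X ∈ K.map (conj P : Alg →ₗ⁅ℂ⁆ Alg),
      ∃ a b c d e : ℂ, X = elt a b c d e 0 0 0 := by
  obtain ⟨P, hP⟩ := exists_first_column K
  have hlow : ∀ X ∈ K.map (conj P : Alg →ₗ⁅ℂ⁆ Alg), ∃ a b c d e g : ℂ, X = elt a b c d e 0 g 0 := by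
    intro X hX
    obtain ⟨a, b, c, d, e, f, g, h, rfl⟩ := exists_elt X
    have := hP _ hX
    simp only [coe_elt] at this
    simp at this
    obtain ⟨rfl, rfl⟩ := this
    exact ⟨_, _, _, _, _, _, rfl⟩
  obtain ⟨w, hw0, hw⟩ := exists_common_eigenvector (L := K.map (conj P : Alg →ₗ⁅ℂ⁆ Alg))
    { toFun := fun X => lowerBlock X, map_add' := fun _ _ => rfl, map_smul' := fun _ _ => rfl }
    (fun X Y => by
      change lowerBlock ((X : M3) * Y - (Y : M3) * X) =
        lowerBlock X * lowerBlock Y - lowerBlock Y * lowerBlock X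
      rw [← lowerBlock_mul _ _ (hP X X.2), ← lowerBlock_mul _ _ (hP Y Y.2)]
      rfl)
  obtain ⟨A, hA, hA1⟩ : ∃ A : M3, A.det ≠ 0 ∧ A *ᵥ Pi.single 0 1 = Pi.single 0 1 ∧
      A *ᵥ Pi.single 1 1 = ![0, w 0, w 1] := by
    by_cases h0 : w 0 = 0
    · have h1 : w 1 ≠ 0 := fun h1 => hw0 (funext fun i => by fin_cases i <;> assumption)
      refine ⟨!![1, 0, 0; 0, w 0, 1; 0, w 1, 0], by simpa [Matrix.det_fin_three], ?_⟩
      constructor <;> rw [Matrix.mulVec_single_one] <;> ext i <;> fin_cases i <;> rfl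
    · refine ⟨!![1, 0, 0; 0, w 0, 0; 0, w 1, 1], by simpa [Matrix.det_fin_three], ?_⟩
      constructor <;> rw [Matrix.mulVec_single_one] <;> ext i <;> fin_cases i <;> rfl
  set Q := Matrix.GeneralLinearGroup.mkOfDetNeZero A hA with hQ
  refine ⟨Q⁻¹ * P, fun Y hY => ?_⟩
  rw [← map_conj_mul] at hY
  obtain ⟨X, hX, h⟩ := mem_map_conj_inv.1 hY
  obtain ⟨t, ht⟩ := hw ⟨X, hX⟩
  replace ht : lowerBlock X *ᵥ w = t • w := ht
  obtain ⟨a, b, c, d, e, g, rfl⟩ := hlow X hX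
  have hQA : (Q : M3) = A := rfl
  have hXe : ((elt a b c d e 0 g 0 : Alg) : M3) *ᵥ Pi.single 0 1 = a • Pi.single 0 1 := by
    rw [Matrix.mulVec_single_one, coe_elt]
    ext i
    fin_cases i <;> simp
  have hXw : ((elt a b c d e 0 g 0 : Alg) : M3) *ᵥ ![0, w 0, w 1] =
      (c * w 0 - e * w 1) • Pi.single 0 1 + t • ![0, w 0, w 1] := by
    have ht0 := congrFun ht 0
    have ht1 := congrFun ht 1
    rw [coe_elt] at ht0 ht1 ⊢
    simp [lowerBlock, Matrix.mulVec, dotProduct] at ht0 ht1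
    ext i
    fin_cases i <;> simp [Matrix.mulVec, dotProduct, Fin.sum_univ_three]
    · ring
    · linear_combination ht0
    · linear_combination ht1
  have hinj := Matrix.mulVec_injective_of_isUnit Q.isUnit
  have h0 : (Y : M3) *ᵥ Pi.single 0 1 = a • Pi.single 0 1 := hinj (by
    rw [Matrix.mulVec_mulVec, h, ← Matrix.mulVec_mulVec, Matrix.mulVec_smul, hQA, hA1.1, hXe])
  have h1 : (Y : M3) *ᵥ Pi.single 1 1 =
      (c * w 0 - e * w 1) • Pi.single 0 1 + t • Pi.single 1 1 := hinj (by
    rw [Matrix.mulVec_mulVec, h, ← Matrix.mulVec_mulVec, Matrix.mulVec_add, Matrix.mulVec_smul,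
      Matrix.mulVec_smul, hQA, hA1.1, hA1.2, hXw])
  rw [Matrix.mulVec_single_one] at h0 h1
  obtain ⟨a', b', c', d', e', f', g', h', rfl⟩ := exists_elt Y
  have e1 := congrFun h0 1
  have e2 := congrFun h0 2
  have e3 := congrFun h1 2
  simp [coe_elt] at e1 e2 e3
  obtain rfl := e1
  obtain rfl := e2
  obtain rfl := e3
  exact ⟨_, _, _, _, _, rfl⟩

/-! ### Three-dimensional subalgebras of the upper triangular matrices -/

theorem exists_not_mem_span_pair {K : LieSubalgebra ℂ Alg} (hK : Module.finrank ℂ K = 3)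
    (X Y : Alg) : ∃ Z ∈ K, ∀ s t : ℂ, s • X + t • Y ≠ Z := by
  by_contra! h
  have hle : K.toSubmodule ≤ Submodule.span ℂ {X, Y} := fun Z hZ =>
    Submodule.mem_span_pair.2 (h Z hZ)
  have h1 := Submodule.finrank_mono hle
  have h2 : Module.finrank ℂ (Submodule.span ℂ {X, Y}) ≤ 2 := by
    classical
    have h3 := finrank_span_finset_le_card (R := ℂ) ({X, Y} : Finset Alg)
    rw [Finset.coe_pair] at h3
    exact h3.trans Finset.card_le_two
  have h4 : Module.finrank ℂ K.toSubmodule = 3 := hK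
  omega

theorem eq_of_le_of_finrank {K K' : LieSubalgebra ℂ Alg} (hK : Module.finrank ℂ K = 3)
    (hK' : Module.finrank ℂ K' = 3) (h : ∀ X ∈ K, X ∈ K') : K = K' := by
  rw [← LieSubalgebra.toSubmodule_inj]
  exact Submodule.eq_of_le_of_finrank_le h (le_of_eq (hK'.trans hK.symm))

theorem classified_of_nilpotent {K : LieSubalgebra ℂ Alg} (hK : Module.finrank ℂ K = 3)
    (h : ∀ X ∈ K, ∃ c d e : ℂ, X = elt 0 0 c d e 0 0 0) : Classified K := by
  refine ⟨.L5_1, ?_⟩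
  rw [eq_of_le_of_finrank hK (listed_properties .L5_1).1 fun X hX => mem_L5_1.2 (h X hX)]
  exact innerEquivalent_refl _

/-- The diagonal element acts on the three positive root spaces with the distinct nonzero weights
`1`, `3`, `4`. The coefficients are those of Lagrange interpolation polynomials without constant
term, so the diagonal part of `X` disappears. -/
theorem root_components {K : LieSubalgebra ℂ Alg} (hs : elt (5 / 3) (7 / 3) 0 0 0 0 0 0 ∈ K)
    {a b c d e : ℂ} (hX : elt a b c d e 0 0 0 ∈ K) :
    elt 0 0 c 0 0 0 0 0 ∈ K ∧ elt 0 0 0 d 0 0 0 0 ∈ K ∧ elt 0 0 0 0 e 0 0 0 ∈ K := by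
  have h1 : elt 0 0 c (3 * d) (4 * e) 0 0 0 ∈ K := mem_of_eq (K.lie_mem hs hX) (by
    rw [elt_lie, elt_inj]; grind)
  have h2 : elt 0 0 c (9 * d) (16 * e) 0 0 0 ∈ K := mem_of_eq (K.lie_mem hs h1) (by
    rw [elt_lie, elt_inj]; grind)
  have h3 : elt 0 0 c (27 * d) (64 * e) 0 0 0 ∈ K := mem_of_eq (K.lie_mem hs h2) (by
    rw [elt_lie, elt_inj]; grind)
  refine ⟨?_, ?_, ?_⟩
  · refine mem_of_eq (K.add_mem (K.add_mem (K.smul_mem (1 / 6) h3) (K.smul_mem (-(7 / 6)) h2))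
      (K.smul_mem 2 h1)) ?_
    simp only [elt_smul, elt_add, elt_inj]; grind
  · refine mem_of_eq (K.add_mem (K.add_mem (K.smul_mem (-(1 / 6)) h3) (K.smul_mem (5 / 6) h2))
      (K.smul_mem (-(2 / 3)) h1)) ?_
    simp only [elt_smul, elt_add, elt_inj]; grind
  · refine mem_of_eq (K.add_mem (K.add_mem (K.smul_mem (1 / 12) h3) (K.smul_mem (-(1 / 3)) h2))
      (K.smul_mem (1 / 4) h1)) ?_
    simp only [elt_smul, elt_add, elt_inj]; grind

theorem classified_of_diagonal_mem {K : LieSubalgebra ℂ Alg} (hK : Module.finrank ℂ K = 3)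
    (htri : ∀ X ∈ K, ∃ a b c d e : ℂ, X = elt a b c d e 0 0 0)
    (hs : elt (5 / 3) (7 / 3) 0 0 0 0 0 0 ∈ K) {c d e : ℂ} (ht : elt 1 0 c d e 0 0 0 ∈ K) :
    Classified K := by
  obtain ⟨hc, hd, he⟩ := root_components hs ht
  have h10 : elt 1 0 0 0 0 0 0 0 ∈ K :=
    mem_of_eq (K.sub_mem (K.sub_mem (K.sub_mem ht hc) hd) he) (by simp [elt_sub])
  have hdiag : ∀ a b : ℂ, elt a b 0 0 0 0 0 0 ∈ K := fun a b =>
    mem_of_eq (K.add_mem (K.smul_mem (3 / 7 * b) hs) (K.smul_mem (a - 5 / 7 * b) h10)) (by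
      simp only [elt_smul, elt_add, elt_inj]; grind)
  obtain ⟨X, hX, hne⟩ := exists_not_mem_span_pair hK h₁ h₂
  obtain ⟨a, b, p, q, r, rfl⟩ := htri X hX
  obtain ⟨hp, hq, hr⟩ := root_components hs hX
  refine classified_torus hK hdiag ?_
  by_cases p0 : p = 0
  · by_cases q0 : q = 0
    · by_cases r0 : r = 0
      · refine (hne a b ?_).elim
        simp [h₁, h₂, elt_smul, elt_add, p0, q0, r0]
      · exact .inr (.inr (mem_of_eq (K.smul_mem r⁻¹ hr) (by simp [elt_smul, r0])))
    · exact .inr (.inl (mem_of_eq (K.smul_mem q⁻¹ hq) (by simp [elt_smul, q0])))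
  · exact .inl (mem_of_eq (K.smul_mem p⁻¹ hp) (by simp [elt_smul, p0]))

theorem unitriangular_mul_eq {a b c d e f g h a' b' c' d' e' u v w : ℂ}
    (H : !![1, u, w; 0, 1, v; 0, 0, 1] * (elt a b c d e f g h : M3) =
      (elt a' b' c' d' e' 0 0 0 : M3) * !![1, u, w; 0, 1, v; 0, 0, 1]) :
    a = a' ∧ b = b' ∧ f = 0 ∧ g = 0 ∧ h = 0 := by
  rw [coe_elt, coe_elt] at H
  have h20 := congrFun (congrFun H 2) 0
  have h21 := congrFun (congrFun H 2) 1
  have h22 := congrFun (congrFun H 2) 2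
  have h10 := congrFun (congrFun H 1) 0
  have h00 := congrFun (congrFun H 0) 0
  simp at h20 h21 h22 h10 h00
  grind

theorem classified_of_diagonal_rank_two {K : LieSubalgebra ℂ Alg} (hK : Module.finrank ℂ K = 3)
    (htri : ∀ X ∈ K, ∃ a b c d e : ℂ, X = elt a b c d e 0 0 0) {a b c d e a' b' c' d' e' : ℂ}
    (h1 : elt a b c d e 0 0 0 ∈ K) (h2 : elt a' b' c' d' e' 0 0 0 ∈ K)
    (hdet : a * b' - a' * b ≠ 0) : Classified K := by
  have hex : ∀ A B : ℂ, ∃ p q r : ℂ, elt A B p q r 0 0 0 ∈ K := fun A B => by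
    have h := K.add_mem (K.smul_mem ((A * b' - B * a') / (a * b' - a' * b)) h1)
      (K.smul_mem ((B * a - A * b) / (a * b' - a' * b)) h2)
    rw [elt_smul, elt_smul, elt_add] at h
    refine ⟨_, _, _, mem_of_eq h (elt_inj.2 ⟨?_, ?_, rfl, rfl, rfl, ?_, ?_, ?_⟩)⟩ <;> grind
  obtain ⟨p, q, r, hs⟩ := hex (5 / 3) (7 / 3)
  obtain ⟨p', q', r', ht⟩ := hex 1 0
  -- The columns are eigenvectors of `elt (5 / 3) (7 / 3) p q r 0 0 0` for its eigenvalues `5/3`,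
  -- `2/3`, `-7/3`.
  have hA : (!![1, -p, (r + p * q / 3) / 4; 0, 1, -(q / 3); 0, 0, 1] : M3).det ≠ 0 := by
    simp [Matrix.det_fin_three]
  set P := Matrix.GeneralLinearGroup.mkOfDetNeZero _ hA with hP
  have hPA : (P : M3) = !![1, -p, (r + p * q / 3) / 4; 0, 1, -(q / 3); 0, 0, 1] := rfl
  have htri' : ∀ Y ∈ K.map (conj P⁻¹ : Alg →ₗ⁅ℂ⁆ Alg),
      ∃ a b c d e : ℂ, Y = elt a b c d e 0 0 0 := by
    intro Y hY
    obtain ⟨X, hX, h⟩ := mem_map_conj_inv.1 hY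
    obtain ⟨_, _, _, _, _, rfl⟩ := htri X hX
    obtain ⟨_, _, _, _, _, _, _, _, rfl⟩ := exists_elt Y
    rw [hPA] at h
    obtain ⟨-, -, rfl, rfl, rfl⟩ := unitriangular_mul_eq h
    exact ⟨_, _, _, _, _, rfl⟩
  have hs' : elt (5 / 3) (7 / 3) 0 0 0 0 0 0 ∈ K.map (conj P⁻¹ : Alg →ₗ⁅ℂ⁆ Alg) := by
    refine mem_map_conj_inv.2 ⟨_, hs, ?_⟩
    rw [hPA, coe_elt, coe_elt]
    ext i j
    fin_cases i <;> fin_cases j <;> simp <;> ring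
  obtain ⟨Y, hY, hYt⟩ : ∃ Y ∈ K.map (conj P⁻¹ : Alg →ₗ⁅ℂ⁆ Alg), conj P Y = elt 1 0 p' q' r' 0 0 0 :=
    ⟨conj P⁻¹ _, ⟨_, ht, rfl⟩, by rw [conj_inv, LieEquiv.apply_symm_apply]⟩
  obtain ⟨x, y, c₁, d₁, e₁, rfl⟩ := htri' Y hY
  rw [conj_eq_iff, hPA] at hYt
  obtain ⟨rfl, rfl, -⟩ := unitriangular_mul_eq hYt
  exact Classified.of_map P⁻¹
    (classified_of_diagonal_mem ((finrank_map_conj K _).trans hK) htri' hs' hY)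

theorem classified_of_root_vectors {K : LieSubalgebra ℂ Alg} (hK : Module.finrank ℂ K = 3)
    {a b c d e p q : ℂ} (hs : elt a b c d e 0 0 0 ∈ K) (hab : a ≠ 0 ∨ b ≠ 0)
    (h13 : elt 0 0 0 0 1 0 0 0 ∈ K) (hz : elt 0 0 p q 0 0 0 0 ∈ K) (hpq : p ≠ 0 ∨ q ≠ 0) :
    Classified K := by
  by_cases hq : q = 0
  · subst hq
    have hp : p ≠ 0 := by simpa using hpq
    have h12 : elt 0 0 1 0 0 0 0 0 ∈ K := mem_of_eq (K.smul_mem p⁻¹ hz) (by simp [elt_smul, hp])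
    refine classified_row (d := d) hK h12 h13 (mem_of_eq (K.sub_mem (K.sub_mem hs (K.smul_mem c h12))
      (K.smul_mem e h13)) ?_) hab
    simp [elt_smul, elt_sub]
  by_cases hp : p = 0
  · subst hp
    have h23 : elt 0 0 0 1 0 0 0 0 ∈ K := mem_of_eq (K.smul_mem q⁻¹ hz) (by simp [elt_smul, hq])
    refine classified_column (c := c) hK h23 h13 (mem_of_eq (K.sub_mem (K.sub_mem hs (K.smul_mem d h23))
      (K.smul_mem e h13)) ?_) hab
    simp [elt_smul, elt_sub]
  by_cases h : a = b
  · subst h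
    refine classified_mixed (c := c - d / q * p) hK hp hq (by simpa using hab) hz h13
      (mem_of_eq (K.sub_mem (K.sub_mem hs (K.smul_mem (d / q) hz)) (K.smul_mem e h13)) ?_)
    simp only [elt_smul, elt_sub, elt_inj]
    grind
  have hab' : a - b ≠ 0 := sub_ne_zero.2 h
  -- For `a ≠ b` the weights of `E₁₂` and `E₂₃` differ by `3 (a - b)`, so bracketing with `s`
  -- separates them. Then `K` contains all strictly upper triangular matrices and by dimension
  -- nothing else, contrary to `s ∈ K`.
  have hlie : elt 0 0 ((2 * a - b) * p) ((2 * b - a) * q) 0 0 0 0 ∈ K :=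
    mem_of_eq (K.sub_mem (K.lie_mem hs hz) (K.smul_mem (d * p - c * q) h13)) (by
      simp only [elt_lie, elt_smul, elt_sub, elt_inj]; grind)
  have h12 : elt 0 0 1 0 0 0 0 0 ∈ K := mem_of_eq (K.sub_mem
    (K.smul_mem (1 / (3 * (a - b) * p)) hlie)
    (K.smul_mem ((2 * b - a) / (3 * (a - b) * p)) hz)) (by
      simp only [elt_smul, elt_sub, elt_inj]; grind)
  have h23 : elt 0 0 0 1 0 0 0 0 ∈ K := mem_of_eq (K.smul_mem q⁻¹
    (K.sub_mem hz (K.smul_mem p h12))) (by simp [elt_smul, elt_sub, hq])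
  have hL : subalg .L5_1 = K := by
    refine eq_of_le_of_finrank (listed_properties _).1 hK fun X hX => ?_
    obtain ⟨x, y, z, rfl⟩ := mem_L5_1.1 hX
    exact mem_of_eq (K.add_mem (K.add_mem (K.smul_mem x h12) (K.smul_mem y h23))
      (K.smul_mem z h13)) (by simp [elt_smul, elt_add])
  rw [← hL] at hs
  obtain ⟨x, y, z, hxyz⟩ := mem_L5_1.1 hs
  rw [elt_inj] at hxyz
  exact (hab.elim (· hxyz.1) (· hxyz.2.1)).elim

/-- Subtracting multiples of `s` leaves two independent strictly upper triangular elements. Either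
their bracket is a nonzero multiple of `E₁₃`, or their `(E₁₂, E₂₃)` parts are dependent and a
combination is such a multiple. -/
theorem classified_of_diagonal_rank_one {K : LieSubalgebra ℂ Alg} (hK : Module.finrank ℂ K = 3)
    (htri : ∀ X ∈ K, ∃ a b c d e : ℂ, X = elt a b c d e 0 0 0) {a b c d e : ℂ}
    (hs : elt a b c d e 0 0 0 ∈ K) (hab : a ≠ 0 ∨ b ≠ 0)
    (hprop : ∀ a' b' c' d' e' : ℂ, elt a' b' c' d' e' 0 0 0 ∈ K → a * b' - a' * b = 0) :
    Classified K := by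
  have hred : ∀ X ∈ K, ∃ t p q r : ℂ, elt 0 0 p q r 0 0 0 ∈ K ∧
      X = t • elt a b c d e 0 0 0 + elt 0 0 p q r 0 0 0 := by
    intro X hX
    obtain ⟨a', b', c', d', e', rfl⟩ := htri X hX
    have h0 := hprop _ _ _ _ _ hX
    obtain ⟨t, hta, htb⟩ : ∃ t, a' = t * a ∧ b' = t * b := by
      rcases hab with ha | hb
      · exact ⟨a' / a, by grind, by grind⟩
      · exact ⟨b' / b, by grind, by grind⟩
    have heq : elt a' b' c' d' e' 0 0 0 - t • elt a b c d e 0 0 0 =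
        elt 0 0 (c' - t * c) (d' - t * d) (e' - t * e) 0 0 0 := by
      simp [elt_smul, elt_sub, hta, htb]
    refine ⟨t, c' - t * c, d' - t * d, e' - t * e, ?_, ?_⟩
    · rw [← heq]
      exact K.sub_mem hX (K.smul_mem t hs)
    · rw [← heq, add_sub_cancel]
  -- With second vector `0` this only asks for an element off the line through `s`.
  obtain ⟨X, hX, hXne⟩ := exists_not_mem_span_pair hK (elt a b c d e 0 0 0) 0
  obtain ⟨t, p, q, r, hN, rfl⟩ := hred X hX
  obtain ⟨Y, hY, hYne⟩ := exists_not_mem_span_pair hK (elt a b c d e 0 0 0) (elt 0 0 p q r 0 0 0)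
  obtain ⟨t', p', q', r', hN', rfl⟩ := hred Y hY
  have hpqr : p = 0 → q = 0 → r ≠ 0 := by
    rintro rfl rfl rfl
    exact hXne t 0 (by rw [elt_zero, smul_zero])
  have hind : ∀ x : ℂ, p' = x * p → q' = x * q → r' ≠ x * r := by
    rintro x rfl rfl rfl
    exact hYne t' x (by simp [elt_smul])
  have h13 : ∀ {x : ℂ}, x ≠ 0 → elt 0 0 0 0 x 0 0 0 ∈ K → elt 0 0 0 0 1 0 0 0 ∈ K :=
    fun {x} hx h => mem_of_eq (K.smul_mem x⁻¹ h) (by simp [elt_smul, hx])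
  by_cases hdet : p * q' - p' * q = 0
  · by_cases hpq : p = 0 ∧ q = 0
    · obtain ⟨rfl, rfl⟩ := hpq
      have hr := hpqr rfl rfl
      have he := h13 hr hN
      refine classified_of_root_vectors hK hs hab he (p := p') (q := q')
        (mem_of_eq (K.sub_mem hN' (K.smul_mem r' he)) (by simp [elt_smul, elt_sub])) ?_
      by_contra! h
      exact hind (r' / r) (by simp [h.1]) (by simp [h.2]) (by field_simp)
    · obtain ⟨x, hxp, hxq⟩ : ∃ x, p' = x * p ∧ q' = x * q := by
        by_cases hp : p = 0
        · have hq : q ≠ 0 := fun hq => hpq ⟨hp, hq⟩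
          exact ⟨q' / q, by grind, by grind⟩
        · exact ⟨p' / p, by grind, by grind⟩
      have he := h13 (sub_ne_zero.2 (hind x hxp hxq)) (mem_of_eq (K.sub_mem hN' (K.smul_mem x hN))
        (by simp [elt_smul, elt_sub, hxp, hxq]))
      refine classified_of_root_vectors hK hs hab he (p := p) (q := q)
        (mem_of_eq (K.sub_mem hN (K.smul_mem r he)) (by simp [elt_smul, elt_sub])) ?_
      by_contra! h
      exact hpq h
  · have he := h13 (x := -(p * q' - p' * q)) (neg_ne_zero.2 hdet)
      (mem_of_eq (K.lie_mem hN hN') (by rw [elt_lie, elt_inj]; grind))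
    refine classified_of_root_vectors hK hs hab he (p := p) (q := q)
      (mem_of_eq (K.sub_mem hN (K.smul_mem r he)) (by simp [elt_smul, elt_sub])) ?_
    by_contra! h
    exact hdet (by simp [h.1, h.2])

theorem classified_of_triangular {K : LieSubalgebra ℂ Alg} (hK : Module.finrank ℂ K = 3)
    (htri : ∀ X ∈ K, ∃ a b c d e : ℂ, X = elt a b c d e 0 0 0) : Classified K := by
  by_cases h0 : ∃ a b c d e : ℂ, elt a b c d e 0 0 0 ∈ K ∧ (a ≠ 0 ∨ b ≠ 0)
  · obtain ⟨a, b, c, d, e, hs, hab⟩ := h0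
    by_cases h2 : ∀ a' b' c' d' e' : ℂ, elt a' b' c' d' e' 0 0 0 ∈ K → a * b' - a' * b = 0
    · exact classified_of_diagonal_rank_one hK htri hs hab h2
    · push Not at h2
      obtain ⟨a', b', c', d', e', ht, hdet⟩ := h2
      exact classified_of_diagonal_rank_two hK htri hs ht hdet
  · push Not at h0
    refine classified_of_nilpotent hK fun X hX => ?_
    obtain ⟨a, b, c, d, e, rfl⟩ := htri X hX
    obtain ⟨rfl, rfl⟩ := h0 _ _ _ _ _ hX
    exact ⟨c, d, e, rfl⟩

theorem classified {K : LieSubalgebra ℂ Alg} (hK : Module.finrank ℂ K = 3)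
    (hs : LieAlgebra.IsSolvable K) : Classified K := by
  obtain ⟨P, hP⟩ := exists_triangular K
  exact Classified.of_map P (classified_of_triangular ((finrank_map_conj K P).trans hK) hP)

end A2

theorem mainTheorem2 :
    -- every listed subalgebra is solvable of dimension three and has the listed isomorphism type
    (∀ l : A2.Label,
      Module.finrank ℂ (A2.subalg l) = 3 ∧
      LieAlgebra.IsSolvable (A2.subalg l) ∧
      A2.HasListedType (A2.subalg l) l) ∧
    -- every three-dimensional solvable subalgebra is equivalent to a listed one
    (∀ K : LieSubalgebra ℂ A2.Alg, Module.finrank ℂ K = 3 → LieAlgebra.IsSolvable K →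
      ∃ l : A2.Label, InnerEquivalent K (A2.subalg l)) ∧
    -- distinct listed subalgebras are inequivalent, except possibly within one of the families
    (∀ l l' : A2.Label, InnerEquivalent (A2.subalg l) (A2.subalg l') →
      l = l' ∨
      (∃ α hα₁ hα₂ β hβ₁ hβ₂, l = .family₁ α hα₁ hα₂ ∧ l' = .family₁ β hβ₁ hβ₂) ∨
      (∃ α hα₁ hα₂ β hβ₁ hβ₂, l = .family₂ α hα₁ hα₂ ∧ l' = .family₂ β hβ₁ hβ₂)) ∧
    -- equivalences within the two families
    (∀ (α β : ℂ) (hα₁ : α ≠ 1) (hα₂ : α ≠ -1) (hβ₁ : β ≠ 1) (hβ₂ : β ≠ -1),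
      (InnerEquivalent (A2.subalg (.family₁ α hα₁ hα₂)) (A2.subalg (.family₁ β hβ₁ hβ₂)) ↔
        α = β ∨ α * β = 1) ∧
      (InnerEquivalent (A2.subalg (.family₂ α hα₁ hα₂)) (A2.subalg (.family₂ β hβ₁ hβ₂)) ↔
        α = β ∨ α * β = 1)) :=
  ⟨A2.listed_properties, fun _ hK hs => A2.classified hK hs, A2.eq_of_equiv,
    fun _ _ hα₁ hα₂ hβ₁ hβ₂ => ⟨A2.family₁_equiv_iff hα₁ hα₂ hβ₁ hβ₂,
      A2.family₂_equiv_iff hα₁ hα₂ hβ₁ hβ₂⟩⟩
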